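/- Let $X$ be a separable complex Hilbert space, let $T(\cdot)$ be an exponentially stable $C_0$-semigroup on $X$ with generator $A$, and let $X_1$ be $D(A)$ with the graph norm. Let $g$ be a bounded analytic function on $\mathbb{C}_-=\{z:\operatorname{Re}z<0\}$, identified with its boundary function in $L^\infty(i\mathbb{R})$. For a Hilbert space $H$ let $\mathfrak{L}$ be the Laplace transform of $L^2((0,\infty),H)$ onto the Hardy space $\mathcal{H}^2(H)\subset L^2(i\mathbb{R},H)$ of the right half-plane, let $\Pi_H$ be the orthogonal projection of $L^2(i\mathbb{R},H)$ onto $\mathcal{H}^2(H)$, and let $M_gf=\mathfrak{L}^{-1}\Pi_H(g\cdot\mathfrak{L}f)$ be the Toeplitz operator on $L^2((0,\infty),H)$. The weak calculus $g(A)$ is the unique operator in $\mathcal{B}(X_1,X)$ such that, for all $y\in X'$ and $x\in D(A)$, $$M_g\big(\langle y,T(\cdot)x\rangle\big)=\langle y,g(A)T(\cdot)x\rangle\quad\text{in }L^2(0,\infty)\qquad(H=\mathbb{C}).$$ The strong calculus $g_s(A)$ is the unique operator in $\mathcal{B}(X_1,X)$ such that, for all $x\in D(A)$, $$M_g\big(T(\cdot)x\big)=g_s(A)T(\cdot)x\quad\text{in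 }L^2((0,\infty),X)\qquad(H=X).$$ For $C\in\mathcal{B}(X_1,X)$ its Lambda extension is $C_\Lambda x=\lim_{\lambda\to\infty}\lambda C(\lambda-A)^{-1}x$, whose domain is the set of all $x\in X$ for which the limit exists; write $g_\Lambda(A)=(g(A))_\Lambda$. Then both operators exist and are unique, $g(A)=g_s(A)$, and therefore $g_\Lambda(A)=(g_s(A))_\Lambda$ (equality of operators with their domains). Moreover $g(A)$ is admissible: there is $m>0$ such that $\|g(A)T(\cdot)x\|_{L^2((0,\infty),X)}\le m\|x\|$ for all $x\in D(A)$. -/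

import Mathlib

open MeasureTheory Filter Set Topology
open scoped NNReal ENNReal FourierTransform

noncomputable section

/-! ### Pointwise limits of operators -/

/-- The (in general unbounded) operator `x ↦ lim_{i → l} F i x`, whose domain consists of all `x`
for which this limit exists. -/
def limitOperator {X ι : Type*} [NormedAddCommGroup X] [NormedSpace ℂ X]
    (l : Filter ι) [l.NeBot] (F : ι → X →ₗ[ℂ] X) : X →ₗ.[ℂ] X where
  domain :=
    { carrier := {x | ∃ z, Tendsto (fun i => F i x) l (𝓝 z)}
      zero_mem' := ⟨0, by simp⟩
      add_mem' := by
        rintro x y ⟨a, ha⟩ ⟨b, hb⟩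
        exact ⟨a + b, by simpa using ha.add hb⟩
      smul_mem' := by
        rintro c x ⟨a, ha⟩
        exact ⟨c • a, by simpa using ha.const_smul c⟩ }
  toFun :=
    { toFun := fun x => limUnder l fun i => F i x
      map_add' := by
        rintro ⟨x, a, ha⟩ ⟨y, b, hb⟩
        have h : Tendsto (fun i => F i (x + y)) l (𝓝 (a + b)) := by simpa using ha.add hb
        rw [ha.limUnder_eq, hb.limUnder_eq]
        exact h.limUnder_eq
      map_smul' := by
        rintro c ⟨x, a, ha⟩
        have h : Tendsto (fun i => F i (c • x)) l (𝓝 (c • a)) := by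
          simpa using ha.const_smul c
        rw [RingHom.id_apply, ha.limUnder_eq]
        exact h.limUnder_eq }

/-! ### Strongly continuous semigroups and their generators -/

/-- A `C₀`-semigroup of bounded operators on `X`. -/
structure C0Semigroup (X : Type*) [NormedAddCommGroup X] [NormedSpace ℂ X] where
  /-- the operators `T(t)`, `t ≥ 0` -/
  op : ℝ≥0 → X →L[ℂ] X
  op_zero : op 0 = 1
  op_add : ∀ s t, op (s + t) = op s ∘L op t
  continuous_orbit : ∀ x, Continuous fun t => op t x

namespace C0Semigroup

variable {X : Type*} [NormedAddCommGroup X] [NormedSpace ℂ X]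

/-- Exponential stability, i.e. negative growth bound: `‖T(t)‖ ≤ M e^{-ε t}` for some `ε > 0`. -/
def ExponentiallyStable (T : C0Semigroup X) : Prop :=
  ∃ M ε : ℝ, 0 < ε ∧ ∀ t : ℝ≥0, ‖T.op t‖ ≤ M * Real.exp (-ε * t)

/-- The generator `A x = lim_{h → 0+} (T(h) x - x) / h`, on the domain where the limit exists. -/
def generator (T : C0Semigroup X) : X →ₗ.[ℂ] X :=
  limitOperator (𝓝[>] (0 : ℝ)) fun h =>
    ((h : ℂ)⁻¹ • (T.op h.toNNReal - 1) : X →L[ℂ] X).toLinearMap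

theorem op_mem_domain (T : C0Semigroup X) (t : ℝ≥0) {x : X} (hx : x ∈ T.generator.domain) :
    T.op t x ∈ T.generator.domain := by
  obtain ⟨z, hz⟩ := hx
  refine ⟨T.op t z, ?_⟩
  refine (((T.op t).continuous.tendsto z).comp hz).congr fun h => ?_
  have hc : T.op t (T.op h.toNNReal x) = T.op h.toNNReal (T.op t x) := by
    have h1 := congrArg (fun S => S x) (T.op_add t h.toNNReal)
    have h2 := congrArg (fun S => S x) (T.op_add h.toNNReal t)
    rw [add_comm] at h2
    exact h1.symm.trans h2
  simp [hc]

/-- The orbit `t ↦ T(t) x`, for `x ∈ D(A)`, as a map into `D(A)`. -/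
def domainOrbit (T : C0Semigroup X) (x : T.generator.domain) (t : ℝ) : T.generator.domain :=
  ⟨T.op t.toNNReal x, T.op_mem_domain _ x.2⟩

/-- `y(T(·) x) ∈ L²((0,∞))` for bounded linear maps `y`, in particular `T(·) x ∈ L²((0,∞), X)`. -/
theorem ExponentiallyStable.memLp_orbit {T : C0Semigroup X} (hT : T.ExponentiallyStable)
    {Y : Type*} [NormedAddCommGroup Y] [NormedSpace ℂ Y] (y : X →L[ℂ] Y) (x : X) :
    MemLp (fun t : ℝ => y (T.op t.toNNReal x)) 2 (volume.restrict (Ioi 0)) := by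
  obtain ⟨M, ε, hε, hM⟩ := hT
  have hcont : Continuous fun t : ℝ => y (T.op t.toNNReal x) :=
    y.continuous.comp ((T.continuous_orbit x).comp continuous_real_toNNReal)
  have hexp : MemLp (fun t : ℝ => Real.exp (-ε * t)) 2 (volume.restrict (Ioi 0)) := by
    rw [memLp_two_iff_integrable_sq (by fun_prop)]
    refine (integrableOn_exp_mul_Ioi (a := -(2 * ε)) (by linarith) 0).congr ?_
    refine Filter.Eventually.of_forall fun t => ?_
    simp only
    rw [← Real.exp_nat_mul]
    congr 1
    push_cast
    ring
  refine (hexp.const_mul (‖y‖ * M * ‖x‖)).of_le hcont.aestronglyMeasurable ?_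
  filter_upwards [ae_restrict_mem measurableSet_Ioi] with t ht
  have h1 : ‖T.op t.toNNReal‖ ≤ M * Real.exp (-ε * t) := by
    simpa [Real.coe_toNNReal t (le_of_lt ht)] using hM t.toNNReal
  calc ‖y (T.op t.toNNReal x)‖ ≤ ‖y‖ * (‖T.op t.toNNReal‖ * ‖x‖) :=
        (y.le_opNorm _).trans (by gcongr; exact (T.op t.toNNReal).le_opNorm x)
    _ ≤ ‖y‖ * (M * Real.exp (-ε * t) * ‖x‖) := by gcongr
    _ = ‖y‖ * M * ‖x‖ * Real.exp (-ε * t) := by ring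
    _ ≤ _ := le_abs_self _

end C0Semigroup

/-! ### Laplace transform, Hardy space and Toeplitz operators -/

/-- Extension by zero `L²((0,∞), H) → L²(ℝ, H)`. -/
def extendZero (H : Type*) [NormedAddCommGroup H] [InnerProductSpace ℂ H] :
    Lp H 2 (volume.restrict (Ioi (0 : ℝ))) →ₗᵢ[ℂ] Lp H 2 (volume : Measure ℝ) where
  toFun f := ((memLp_indicator_iff_restrict measurableSet_Ioi).2 (Lp.memLp f)).toLp
    ((Ioi (0 : ℝ)).indicator f)
  map_add' f g := by
    rw [← MemLp.toLp_add]
    apply MemLp.toLp_congr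
    rw [← indicator_add']
    exact (ae_eq_restrict_iff_indicator_ae_eq measurableSet_Ioi).1 (Lp.coeFn_add f g)
  map_smul' c f := by
    rw [RingHom.id_apply, ← MemLp.toLp_const_smul]
    apply MemLp.toLp_congr
    have h := (ae_eq_restrict_iff_indicator_ae_eq measurableSet_Ioi).1 (Lp.coeFn_smul c f)
    refine h.trans (Filter.Eventually.of_forall fun t => ?_)
    by_cases ht : t ∈ Ioi (0 : ℝ) <;> simp [ht]
  norm_map' f := by
    simp only [LinearMap.coe_mk, AddHom.coe_mk]
    rw [Lp.norm_toLp, eLpNorm_indicator_eq_eLpNorm_restrict measurableSet_Ioi, Lp.norm_def]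

section Toeplitz

variable (H : Type*) [NormedAddCommGroup H] [InnerProductSpace ℂ H] [CompleteSpace H]

/-- The Laplace transform on `L²((0,∞), H)`, `(𝔏 f)(s) = ∫₀^∞ e^{-st} f(t) dt`, as a function on
the imaginary axis parametrised by `s = 2πiξ`, `ξ ∈ ℝ`; there it is the `L²` Fourier transform
(with kernel `e^{-2πiξt}`) of the extension of `f` by zero. -/
def laplace : Lp H 2 (volume.restrict (Ioi (0 : ℝ))) →ₗᵢ[ℂ] Lp H 2 (volume : Measure ℝ) :=
  (Lp.fourierTransformₗᵢ ℝ H).toLinearIsometry.comp (extendZero H)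

/-- The Hardy space `H²(H)` of the right half-plane, as a space of boundary functions:
the Laplace transforms of the elements of `L²((0,∞), H)`. -/
def hardySpace : Submodule ℂ (Lp H 2 (volume : Measure ℝ)) :=
  (laplace H).toLinearMap.range

instance hardySpace.completeSpace : CompleteSpace (hardySpace H) :=
  ((laplace H).equivRange.symm.isometry.isUniformInducing.completeSpace_congr
    (laplace H).equivRange.symm.surjective).2 inferInstance

/-- The Laplace transform as a unitary map of `L²((0,∞), H)` onto `H²(H)`. -/
def laplaceEquiv : Lp H 2 (volume.restrict (Ioi (0 : ℝ))) ≃ₗᵢ[ℂ] hardySpace H :=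
  (laplace H).equivRange

end Toeplitz

/-- `g ∈ H^∞₋`: `g` is bounded and analytic on the left half-plane. -/
def IsHInfty (g : ℂ → ℂ) : Prop :=
  DifferentiableOn ℂ g {z | z.re < 0} ∧ ∃ K : ℝ, ∀ z : ℂ, z.re < 0 → ‖g z‖ ≤ K

open Classical in
/-- The boundary function in `L^∞(iℝ)` of `g ∈ H^∞₋`, given almost everywhere by the limits of `g`
along horizontal lines, again with `s = 2πiξ`.  (By Fatou's theorem it exists for `g ∈ H^∞₋`; the
default value `0` is never used for such `g`.) -/
def boundaryFunction (g : ℂ → ℂ) : Lp ℂ ∞ (volume : Measure ℝ) :=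
  if h : ∃ b : Lp ℂ ∞ (volume : Measure ℝ), ∀ᵐ ξ : ℝ,
      Tendsto (fun σ : ℝ => g (σ + 2 * Real.pi * ξ * Complex.I)) (𝓝[<] 0) (𝓝 (b ξ))
  then h.choose else 0

/-- The Toeplitz operator `M_g f = 𝔏⁻¹ Π (g · 𝔏 f)` on `L²((0,∞), H)`, with `Π` the orthogonal
projection of `L²(iℝ, H)` onto `H²(H)`. -/
def toeplitz (H : Type*) [NormedAddCommGroup H] [InnerProductSpace ℂ H] [CompleteSpace H]
    (g : ℂ → ℂ) :
    Lp H 2 (volume.restrict (Ioi (0 : ℝ))) →L[ℂ] Lp H 2 (volume.restrict (Ioi (0 : ℝ))) :=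
  (laplaceEquiv H).symm.toContinuousLinearEquiv.toContinuousLinearMap ∘L
    (hardySpace H).orthogonalProjectionOnto ∘L
    ((ContinuousLinearMap.lsmul ℂ ℂ).holderL volume ∞ 2 2 (boundaryFunction g)) ∘L
    (laplace H).toContinuousLinearMap

/-! ### Operators on `D(A)`, the weak and the strong calculus -/

section Calculus

variable {X : Type*} [NormedAddCommGroup X]

/-- `C ∈ B(X₁, Y)`, where `X₁` is `D(A)` with the graph norm of `A`. -/
def IsGraphBounded [NormedSpace ℂ X] {Y : Type*} [NormedAddCommGroup Y] [NormedSpace ℂ Y]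
    (A : X →ₗ.[ℂ] X) (C : A.domain →ₗ[ℂ] Y) : Prop :=
  ∃ c : ℝ, ∀ x : A.domain, ‖C x‖ ≤ c * (‖(x : X)‖ + ‖A x‖)

/-- Admissibility of `C ∈ B(X₁, Y)` for the semigroup `T`: there is `m > 0` with
`‖C T(·) x‖_{L²((0,∞),Y)} ≤ m ‖x‖` for all `x ∈ D(A)`. -/
def IsAdmissible [NormedSpace ℂ X] {Y : Type*} [NormedAddCommGroup Y] [NormedSpace ℂ Y]
    (T : C0Semigroup X) (C : T.generator.domain →ₗ[ℂ] Y) : Prop :=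
  IsGraphBounded T.generator C ∧ ∃ m : ℝ, 0 < m ∧ ∀ x : T.generator.domain,
    MemLp (fun t : ℝ => C (T.domainOrbit x t)) 2 (volume.restrict (Ioi 0)) ∧
    eLpNorm (fun t : ℝ => C (T.domainOrbit x t)) 2 (volume.restrict (Ioi 0))
      ≤ ENNReal.ofReal (m * ‖(x : X)‖)

/-- The weak output `𝔇_{g,y} x = M_g ⟨y, T(·) x⟩ ∈ L²(0,∞)`. -/
def weakOutput [NormedSpace ℂ X] {T : C0Semigroup X} (hT : T.ExponentiallyStable) (g : ℂ → ℂ)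
    (y : StrongDual ℂ X) (x : X) : Lp ℂ 2 (volume.restrict (Ioi (0 : ℝ))) :=
  toeplitz ℂ g ((hT.memLp_orbit y x).toLp fun t : ℝ => y (T.op t.toNNReal x))

/-- The defining property of the weak calculus: `C ∈ B(X₁, X)` and
`𝔇_{g,y} x = ⟨y, C T(·) x⟩` for all `y ∈ X'` and `x ∈ D(A)`. -/
def IsWeakCalculus [NormedSpace ℂ X] {T : C0Semigroup X} (hT : T.ExponentiallyStable) (g : ℂ → ℂ)
    (C : T.generator.domain →ₗ[ℂ] X) : Prop :=
  IsGraphBounded T.generator C ∧ ∀ (y : StrongDual ℂ X) (x : T.generator.domain),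
    weakOutput hT g y x =ᵐ[volume.restrict (Ioi (0 : ℝ))] fun t => y (C (T.domainOrbit x t))

open Classical in
/-- The operator `g(A) : D(A) → X` of the weak calculus. -/
def weakCalculus [NormedSpace ℂ X] {T : C0Semigroup X} (hT : T.ExponentiallyStable) (g : ℂ → ℂ) :
    T.generator.domain →ₗ[ℂ] X :=
  if h : ∃ C, IsWeakCalculus hT g C then h.choose else 0

/-- The strong output `𝔇_g x = M_g (T(·) x) ∈ L²((0,∞), X)`. -/
def strongOutput [InnerProductSpace ℂ X] [CompleteSpace X] {T : C0Semigroup X}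
    (hT : T.ExponentiallyStable) (g : ℂ → ℂ) (x : X) : Lp X 2 (volume.restrict (Ioi (0 : ℝ))) :=
  toeplitz X g ((hT.memLp_orbit (.id ℂ X) x).toLp fun t : ℝ => T.op t.toNNReal x)

/-- The defining property of the strong calculus: `C ∈ B(X₁, X)` and `𝔇_g x = C T(·) x` for all
`x ∈ D(A)`. -/
def IsStrongCalculus [InnerProductSpace ℂ X] [CompleteSpace X] {T : C0Semigroup X}
    (hT : T.ExponentiallyStable) (g : ℂ → ℂ) (C : T.generator.domain →ₗ[ℂ] X) : Prop :=
  IsGraphBounded T.generator C ∧ ∀ x : T.generator.domain,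
    strongOutput hT g x =ᵐ[volume.restrict (Ioi (0 : ℝ))] fun t => C (T.domainOrbit x t)

open Classical in
/-- The operator `g_s(A) : D(A) → X` of the strong calculus. -/
def strongCalculus [InnerProductSpace ℂ X] [CompleteSpace X] {T : C0Semigroup X}
    (hT : T.ExponentiallyStable) (g : ℂ → ℂ) : T.generator.domain →ₗ[ℂ] X :=
  if h : ∃ C, IsStrongCalculus hT g C then h.choose else 0

open Classical in
/-- The resolvent `R(z, A) = (z - A)⁻¹ : X → D(A)` (and `0` if `z - A` is not bijective). -/
def resolventMap [NormedSpace ℂ X] (A : X →ₗ.[ℂ] X) (z : ℂ) : X →ₗ[ℂ] A.domain :=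
  if h : Function.Bijective (z • A.domain.subtype - A.toFun) then
    (LinearEquiv.ofBijective (z • A.domain.subtype - A.toFun) h).symm.toLinearMap
  else 0

/-- The Lambda extension `C_Λ x = lim_{λ → ∞} λ C R(λ, A) x`, on the domain where the limit
exists. -/
def lambdaExtension [NormedSpace ℂ X] (A : X →ₗ.[ℂ] X) (C : A.domain →ₗ[ℂ] X) : X →ₗ.[ℂ] X :=
  limitOperator atTop fun r : ℝ => (r : ℂ) • (C ∘ₗ resolventMap A r)

end Calculus

end

/-! Write s = 2πiξ. Since g(s)/(1 - s) is square integrable on the axis, R x = ∫ g(s)/(1 - s) (𝔏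
T(·)x)(s) dξ defines a bounded operator on X (`resolventCalculus`). It plays the role of g(A)(1 -
A)⁻¹, and C = R(1 - A) on D(A) (`calculus`) is the candidate for both calculi.

Let w = x - Ax. Integration by parts gives 𝔏(T(·)w) = (1 - s) 𝔏(T(·)x) + x, so g 𝔏(T(·)x) = g/(1 -
s) 𝔏(T(·)w) - g/(1 - s) x. Cauchy's theorem shows that g/(1 - s) integrates to zero against
transforms of functions living on (-∞, 0] (`integral_boundary_smul_fourier_eq_zero`). Hence the
inverse transform of the second term vanishes on (0,∞). That of the first at t > 0 is R T(t)w = C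
T(t)x, because e^{st} 𝔏(T(·)w) and 𝔏(T(·)T(t)w) differ by such a transform (`resolventCalculus_op`).
As 𝔏⁻¹Π𝓕 is restriction to (0,∞), C is a strong calculus (`toeplitz_orbitL_ae_eq`).

Toeplitz operators with scalar symbol commute with functionals, so a strong calculus is a weak one.
Weak calculi are unique because t ↦ C T(t)x is continuous at 0. This gives the equality of the two
calculi, and admissibility is the boundedness of M_g composed with x ↦ T(·)x.

The boundary values of g come from Fatou's theorem, proved here through a primitive of g: it is
Lipschitz, hence differentiable almost everywhere along the axis. -/

/-! ### Complex analysis in the left half-plane -/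

/-- **Cauchy's theorem** on the left half-plane, for functions with quadratic decay. -/
theorem integral_imaginaryAxis_eq_zero {H : ℂ → ℂ} (hc : ContinuousOn H {z | z.re ≤ 0})
    (hd : DifferentiableOn ℂ H {z | z.re < 0}) (hi : Integrable fun y : ℝ => H (y * Complex.I))
    {M R₀ : ℝ} (hM : ∀ z : ℂ, z.re ≤ 0 → R₀ ≤ ‖z‖ → ‖H z‖ ≤ M / ‖z‖ ^ 2) :
    ∫ y : ℝ, H (y * Complex.I) = 0 := by
  have hlim : Tendsto (fun R : ℝ => ∫ y in (-R)..R, H (y * Complex.I)) atTop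
      (𝓝 (∫ y : ℝ, H (y * Complex.I))) :=
    intervalIntegral_tendsto_integral hi tendsto_neg_atTop_atBot tendsto_id
  -- The other three sides of the rectangle [-R, 0] × [-R, R] have total length 4R, and H is at most
  -- |M|/R² on them.
  have hbound : ∀ᶠ R : ℝ in atTop, ‖∫ y in (-R)..R, H (y * Complex.I)‖ ≤ 4 * |M| / R := by
    filter_upwards [eventually_ge_atTop R₀, eventually_gt_atTop 0] with R hR hR0
    have hM' : ∀ z : ℂ, z.re ≤ 0 → R ≤ ‖z‖ → ‖H z‖ ≤ |M| / R ^ 2 := fun z hz hzR =>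
      (hM z hz (hR.trans hzR)).trans (by gcongr; exact le_abs_self M)
    have hrect := Complex.integral_boundary_rect_eq_zero_of_continuousOn_of_differentiableOn H
      (⟨-R, -R⟩ : ℂ) (⟨0, R⟩ : ℂ)
      (hc.mono fun z hz => by
        have := hz.1
        simp only [mem_preimage, uIcc_of_le (by linarith : -R ≤ 0)] at this
        exact this.2)
      (hd.mono fun z hz => by
        have := hz.1
        simp only [mem_preimage, max_eq_right (by linarith : -R ≤ 0)] at this
        exact this.2)
    simp only [Complex.ofReal_zero, zero_add, smul_eq_mul] at hrect
    have h1 : ‖∫ x : ℝ in (-R)..0, H (x + (-R : ℝ) * Complex.I)‖ ≤ |M| / R ^ 2 * |0 - -R| := by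
      refine intervalIntegral.norm_integral_le_of_norm_le_const fun x hx => ?_
      rw [uIoc_of_le (by linarith)] at hx
      refine hM' _ (by simpa using hx.2) ?_
      refine le_trans ?_ (Complex.abs_im_le_norm _)
      simp [abs_of_pos hR0]
    have h2 : ‖∫ x : ℝ in (-R)..0, H (x + R * Complex.I)‖ ≤ |M| / R ^ 2 * |0 - -R| := by
      refine intervalIntegral.norm_integral_le_of_norm_le_const fun x hx => ?_
      rw [uIoc_of_le (by linarith)] at hx
      refine hM' _ (by simpa using hx.2) ?_
      refine le_trans ?_ (Complex.abs_im_le_norm _)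
      simp [abs_of_pos hR0]
    have h3 : ‖∫ y : ℝ in (-R)..R, H ((-R : ℝ) + y * Complex.I)‖ ≤ |M| / R ^ 2 * |R - -R| := by
      refine intervalIntegral.norm_integral_le_of_norm_le_const fun y _ => ?_
      refine hM' _ (by simpa using hR0.le) ?_
      refine le_trans ?_ (Complex.abs_re_le_norm _)
      simp [abs_of_pos hR0]
    have hI : ‖∫ y in (-R)..R, H (y * Complex.I)‖
        = ‖Complex.I * ∫ y in (-R)..R, H (y * Complex.I)‖ := by simp
    have hsplit : Complex.I * (∫ y in (-R)..R, H (y * Complex.I))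
        = Complex.I * (∫ y : ℝ in (-R)..R, H ((-R : ℝ) + y * Complex.I))
          - (∫ x : ℝ in (-R)..0, H (x + (-R : ℝ) * Complex.I))
          + ∫ x : ℝ in (-R)..0, H (x + R * Complex.I) := by
      linear_combination hrect
    rw [hI, hsplit]
    refine (norm_add_le _ _).trans ((add_le_add_left (norm_sub_le _ _) _).trans ?_)
    rw [norm_mul, Complex.norm_I, one_mul]
    refine (add_le_add (add_le_add h3 h1) h2).trans (le_of_eq ?_)
    rw [abs_of_pos (by linarith : 0 < R - -R), abs_of_pos (by linarith : 0 < 0 - -R)]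
    field_simp
    ring
  have hz : Tendsto (fun R : ℝ => 4 * |M| / R) atTop (𝓝 0) :=
    tendsto_const_nhds.div_atTop tendsto_id
  exact tendsto_nhds_unique hlim (squeeze_zero_norm' hbound hz)

/-! ### Fatou's theorem by way of a Lipschitz primitive. -/

/-- A holomorphic function on the left half-plane has a primitive. -/
theorem exists_primitive_leftHalfPlane {g : ℂ → ℂ} (hg : DifferentiableOn ℂ g {z | z.re < 0}) :
    ∃ F : ℂ → ℂ, ∀ z : ℂ, z.re < 0 → HasDerivAt F (g z) z := by
  -- The Cayley transform z = (w - 1)/(w + 1), with dz = 2/(w + 1)² dw, moves the problem to the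
  -- unit disc, where primitives exist.
  have hne : ∀ w ∈ Metric.ball (0 : ℂ) 1, w + 1 ≠ 0 := fun w hw h => by
    have : w = -1 := by linear_combination h
    simp [this] at hw
  have hmaps : MapsTo (fun w : ℂ => (w - 1) / (w + 1)) (Metric.ball 0 1) {z | z.re < 0} := by
    intro w hw
    have h0 := Complex.normSq_pos.2 (hne w hw)
    have h1 : ‖w‖ ^ 2 < 1 := by
      have : ‖w‖ < 1 := by simpa using hw
      nlinarith [norm_nonneg w]
    rw [← Complex.normSq_eq_norm_sq, Complex.normSq_apply] at h1
    simp only [mem_ofPred_eq, Complex.div_re]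
    rw [← add_div]
    refine div_neg_of_neg_of_pos ?_ h0
    simp
    nlinarith
  have hdiff : DifferentiableOn ℂ (fun w : ℂ => g ((w - 1) / (w + 1)) * (2 / (w + 1) ^ 2))
      (Metric.ball 0 1) := by
    refine DifferentiableOn.mul (hg.comp (DifferentiableOn.div (by fun_prop) (by fun_prop) hne)
      hmaps) (DifferentiableOn.div (by fun_prop) (by fun_prop) fun w hw => ?_)
    exact pow_ne_zero 2 (hne w hw)
  obtain ⟨P, hP⟩ := hdiff.isExactOn_ball
  refine ⟨fun z => P ((1 + z) / (1 - z)), fun z hz => ?_⟩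
  have hz1 : 1 - z ≠ 0 := fun h => by
    have : z = 1 := by linear_combination -h
    simp [this] at hz
    linarith
  have hw : (1 + z) / (1 - z) ∈ Metric.ball (0 : ℂ) 1 := by
    rw [mem_ball_zero_iff, norm_div, div_lt_one (norm_pos_iff.2 hz1)]
    refine lt_of_pow_lt_pow_left₀ 2 (norm_nonneg _) ?_
    rw [← Complex.normSq_eq_norm_sq, ← Complex.normSq_eq_norm_sq, Complex.normSq_apply,
      Complex.normSq_apply]
    simp
    nlinarith
  have h1 : HasDerivAt (fun z : ℂ => (1 + z) / (1 - z)) (2 / (1 - z) ^ 2) z := by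
    have := ((hasDerivAt_id z).const_add 1).div ((hasDerivAt_id z).const_sub 1) hz1
    refine this.congr_deriv ?_
    rw [id_eq]
    ring
  have h2 := (hP _ hw).comp z h1
  simp only at h2
  have hw1 : (1 + z) / (1 - z) + 1 = 2 / (1 - z) := by field_simp; ring
  have hw2 : ((1 + z) / (1 - z) - 1) / ((1 + z) / (1 - z) + 1) = z := by
    rw [hw1]; field_simp; ring
  rw [hw2, hw1] at h2
  refine h2.congr_deriv ?_
  field_simp

/-- Expand: |1 - z|² = 1 - 2 Re z + |z|². -/
theorem norm_one_sub_sq_ge {z : ℂ} (hz : z.re ≤ 0) : 1 + ‖z‖ ^ 2 ≤ ‖1 - z‖ ^ 2 := by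
  rw [← Complex.normSq_eq_norm_sq, ← Complex.normSq_eq_norm_sq, Complex.normSq_apply,
    Complex.normSq_apply]
  simp
  nlinarith

/-- The derivative at `-1` of a function of at most linear growth in the left half-plane, in terms
of its values on the imaginary axis. -/
theorem deriv_neg_one_mul_integral {E : ℂ → ℂ} (hc : Continuous E)
    (hd : DifferentiableOn ℂ E {z | z.re < 0}) {L : ℝ} (hL : ∀ z, ‖E z‖ ≤ L * ‖z‖) :
    deriv E (-1) * ((∫ y : ℝ, y ^ 2 / (1 + y ^ 2) ^ 2 : ℝ) : ℂ)
      = -∫ y : ℝ, E (y * Complex.I) * (y * Complex.I / (1 + y ^ 2) ^ 2) := by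
  have hn : {z : ℂ | z.re < 0} ∈ 𝓝 (-1 : ℂ) :=
    (isOpen_lt Complex.continuous_re continuous_const).mem_nhds (by simp)
  have hn' : {z : ℂ | z.re ≤ 0} ∈ 𝓝 (-1 : ℂ) := mem_of_superset hn fun z (hz : z.re < 0) => hz.le
  -- The second divided difference at -1 has no pole there, so Cauchy's theorem applies to D(z) z/(z
  -- - 1)². On the axis (z + 1)²(z - 1)² = (1 + y²)². The factor z makes the contribution of E(-1)
  -- odd, so only E and E'(-1) survive integration.
  set D := dslope (dslope E (-1)) (-1) with hD
  have hDd : DifferentiableOn ℂ D {z | z.re < 0} :=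
    (Complex.differentiableOn_dslope hn).2 ((Complex.differentiableOn_dslope hn).2 hd)
  have hDc : ContinuousOn D {z | z.re ≤ 0} := by
    refine (continuousOn_dslope hn').2 ⟨(continuousOn_dslope hn').2
      ⟨hc.continuousOn, hd.differentiableAt hn⟩, ?_⟩
    exact ((Complex.differentiableOn_dslope hn).2 hd).differentiableAt hn
  have hDe : ∀ z : ℂ, z ≠ -1 → D z = (E z - E (-1) - (z + 1) * deriv E (-1)) / (z + 1) ^ 2 := by
    intro z hz
    have hz' : z + 1 ≠ 0 := fun h => hz (by linear_combination h)
    rw [hD, dslope_of_ne _ hz, slope_def_field, dslope_of_ne _ hz, dslope_same, slope_def_field,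
      sub_neg_eq_add]
    field_simp
  have hz1 : ∀ z : ℂ, z.re ≤ 0 → z - 1 ≠ 0 := fun z hz h => by
    have : z = 1 := by linear_combination h
    simp [this] at hz
    linarith
  have hax : ∀ y : ℝ, D (y * Complex.I) * (y * Complex.I / (y * Complex.I - 1) ^ 2)
      = E (y * Complex.I) * (y * Complex.I / (1 + y ^ 2) ^ 2)
        + (-(E (-1) + deriv E (-1)) * Complex.I) * ((y / (1 + y ^ 2) ^ 2 : ℝ) : ℂ)
        + deriv E (-1) * ((y ^ 2 / (1 + y ^ 2) ^ 2 : ℝ) : ℂ) := by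
    intro y
    have hy : (y * Complex.I : ℂ) ≠ -1 := fun h => by
      have := congrArg Complex.re h
      simp at this
    have hy1 : (y * Complex.I + 1 : ℂ) ≠ 0 := fun h => hy (by linear_combination h)
    have hy2 := hz1 (y * Complex.I) (by simp)
    have hy3 : (1 + (y : ℂ) ^ 2) = -((y * Complex.I + 1) * (y * Complex.I - 1)) := by
      ring_nf; rw [Complex.I_sq]; ring
    rw [hDe _ hy]
    push_cast
    rw [hy3]
    field_simp
    ring_nf
    rw [Complex.I_sq]
    ring
  have hbase : Integrable fun y : ℝ => (1 + y ^ 2)⁻¹ := integrable_inv_one_add_sq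
  have hpos : ∀ y : ℝ, 0 < 1 + y ^ 2 := fun y => by positivity
  have hi1 : Integrable fun y : ℝ => E (y * Complex.I) * (y * Complex.I / (1 + y ^ 2) ^ 2) := by
    refine (hbase.const_mul L).mono' ?_ (Eventually.of_forall fun y => ?_)
    · refine Continuous.aestronglyMeasurable ?_
      refine Continuous.mul (by fun_prop) (Continuous.div (by fun_prop) (by fun_prop) fun y => ?_)
      exact_mod_cast (pow_pos (hpos y) 2).ne'
    · have h1 := hL (y * Complex.I)
      have h2 : ‖(1 + (y : ℂ) ^ 2) ^ 2‖ = (1 + y ^ 2) ^ 2 := by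
        rw [norm_pow, ← Complex.ofReal_pow, ← Complex.ofReal_one, ← Complex.ofReal_add,
          Complex.norm_real, Real.norm_of_nonneg (hpos y).le]
      have hL0 : 0 ≤ L := by simpa using (norm_nonneg _).trans (hL 1)
      simp only [norm_mul, norm_div, Complex.norm_real, Complex.norm_I, mul_one, h2] at h1 ⊢
      calc ‖E (y * Complex.I)‖ * (‖y‖ / (1 + y ^ 2) ^ 2)
          ≤ L * ‖y‖ * (‖y‖ / (1 + y ^ 2) ^ 2) := by gcongr
        _ = L * (y ^ 2 / (1 + y ^ 2) ^ 2) := by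
            rw [Real.norm_eq_abs, ← sq_abs y]; ring
        _ ≤ L * ((1 + y ^ 2) / (1 + y ^ 2) ^ 2) := by gcongr; linarith
        _ = L * (1 + y ^ 2)⁻¹ := by have := hpos y; field_simp
  have hi2 : Integrable fun y : ℝ => y / (1 + y ^ 2) ^ 2 := by
    refine hbase.mono' (Continuous.aestronglyMeasurable (Continuous.div (by fun_prop)
      (by fun_prop) fun y => (pow_pos (hpos y) 2).ne')) (Eventually.of_forall fun y => ?_)
    have := hpos y
    rw [norm_div, Real.norm_of_nonneg (pow_pos this 2).le, div_le_iff₀ (by positivity)]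
    field_simp
    rw [Real.norm_eq_abs]
    nlinarith [sq_nonneg (|y| - 1), sq_abs y]
  have hi3 : Integrable fun y : ℝ => y ^ 2 / (1 + y ^ 2) ^ 2 := by
    refine hbase.mono' (Continuous.aestronglyMeasurable (Continuous.div (by fun_prop)
      (by fun_prop) fun y => (pow_pos (hpos y) 2).ne')) (Eventually.of_forall fun y => ?_)
    have := hpos y
    rw [Real.norm_of_nonneg (by positivity), div_le_iff₀ (by positivity)]
    field_simp
    linarith
  have hodd : ∫ y : ℝ, y / (1 + y ^ 2) ^ 2 = 0 := by
    have h := integral_neg_eq_self (fun y : ℝ => y / (1 + y ^ 2) ^ 2) volume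
    simp only [neg_div, even_two.neg_pow, integral_neg] at h
    linarith
  have hi2' : Integrable fun y : ℝ =>
      (-(E (-1) + deriv E (-1)) * Complex.I) * ((y / (1 + y ^ 2) ^ 2 : ℝ) : ℂ) :=
    hi2.ofReal.const_mul _
  have hi3' : Integrable fun y : ℝ => deriv E (-1) * ((y ^ 2 / (1 + y ^ 2) ^ 2 : ℝ) : ℂ) :=
    hi3.ofReal.const_mul _
  have hmain := integral_imaginaryAxis_eq_zero (H := fun z => D z * (z / (z - 1) ^ 2))
    -- For |z| ≥ 2 one has |z + 1| ≥ |z|/2, whose inverse square gives the factor 4; the factor 2 is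
    -- slack.
    (R₀ := 2) (M := 4 * (2 * (L + ‖E (-1)‖ + 2 * ‖deriv E (-1)‖)))
    (hDc.mul (ContinuousOn.div (by fun_prop) (by fun_prop) fun z hz => pow_ne_zero 2 (hz1 z hz)))
    (hDd.mul (DifferentiableOn.div (by fun_prop) (by fun_prop)
      fun z (hz : z.re < 0) => pow_ne_zero 2 (hz1 z hz.le)))
    (by simp only [hax]; exact (hi1.add hi2').add hi3') ?_
  · simp only [hax] at hmain
    rw [integral_add (by exact hi1.add hi2') hi3', integral_add hi1 hi2', integral_const_mul,
      integral_const_mul, integral_complex_ofReal, integral_complex_ofReal, hodd] at hmain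
    simp only [Complex.ofReal_zero, mul_zero, add_zero] at hmain
    linear_combination hmain
  · intro z hz hz2
    have hne : z ≠ -1 := fun h => by simp [h] at hz2
    have ha : ‖z‖ / 2 ≤ ‖z + 1‖ := by
      have := norm_sub_le (z + 1) 1
      simp at this
      linarith
    have hb : ‖z‖ ^ 2 ≤ ‖z - 1‖ ^ 2 := by
      rw [norm_sub_rev]
      linarith [norm_one_sub_sq_ge hz]
    have hL0 : 0 ≤ L := by simpa using (norm_nonneg _).trans (hL 1)
    have hnum : ‖E z - E (-1) - (z + 1) * deriv E (-1)‖
        ≤ (L + ‖E (-1)‖ + 2 * ‖deriv E (-1)‖) * ‖z‖ := by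
      have h1 := norm_sub_le (E z - E (-1)) ((z + 1) * deriv E (-1))
      have h2 := norm_sub_le (E z) (E (-1))
      have h3 := hL z
      have h4 : ‖z + 1‖ ≤ 2 * ‖z‖ := by
        have := norm_add_le z 1
        simp at this
        linarith
      rw [norm_mul] at h1
      have h5 : ‖z + 1‖ * ‖deriv E (-1)‖ ≤ 2 * ‖z‖ * ‖deriv E (-1)‖ := by gcongr
      have h6 : ‖E (-1)‖ ≤ ‖E (-1)‖ * ‖z‖ := by
        nlinarith [norm_nonneg (E (-1))]
      linarith
    have hz0 : 0 < ‖z‖ := by linarith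
    rw [hDe z hne, norm_mul, norm_div, norm_div, norm_pow, norm_pow]
    set A := L + ‖E (-1)‖ + 2 * ‖deriv E (-1)‖ with hA
    have hA0 : 0 ≤ A := by positivity
    calc _ ≤ A * ‖z‖ / (‖z‖ / 2) ^ 2 * (‖z‖ / ‖z‖ ^ 2) := by gcongr
      _ = 4 * A / ‖z‖ ^ 2 * ‖z‖ ^ 2 / ‖z‖ ^ 2 := by field_simp; ring
      _ ≤ 4 * (2 * A) / ‖z‖ ^ 2 := by
          rw [div_mul_cancel₀ _ (by positivity)]
          gcongr
          linarith


/-- Fatou's theorem, at boundary points where a Lipschitz primitive is differentiable. -/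
theorem exists_tendsto_of_differentiableAt_primitive {g F : ℂ → ℂ} {K : ℝ≥0}
    (hF : LipschitzWith K F) (hFg : ∀ z : ℂ, z.re < 0 → HasDerivAt F (g z) z) {y₀ : ℝ}
    (hy : DifferentiableAt ℝ (fun y : ℝ => F (y * Complex.I)) y₀) :
    ∃ c, Tendsto (fun σ : ℝ => g (σ + y₀ * Complex.I)) (𝓝[<] 0) (𝓝 c) := by
  set φ : ℝ → ℂ := fun y => F (y * Complex.I) with hφ
  set c₀ : ℝ := ∫ y : ℝ, y ^ 2 / (1 + y ^ 2) ^ 2 with hc₀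
  have hpos : ∀ y : ℝ, 0 < 1 + y ^ 2 := fun y => by positivity
  have hbase : Integrable fun y : ℝ => (1 + y ^ 2)⁻¹ := integrable_inv_one_add_sq
  have hc0 : (c₀ : ℂ) ≠ 0 := by
    have hcont : Continuous fun y : ℝ => y ^ 2 / (1 + y ^ 2) ^ 2 :=
      Continuous.div (by fun_prop) (by fun_prop) fun y => (pow_pos (hpos y) 2).ne'
    have hi : Integrable fun y : ℝ => y ^ 2 / (1 + y ^ 2) ^ 2 := by
      refine hbase.mono' hcont.aestronglyMeasurable (Eventually.of_forall fun y => ?_)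
      have := hpos y
      rw [Real.norm_of_nonneg (by positivity), div_le_iff₀ (by positivity)]
      field_simp
      linarith
    have : 0 < c₀ := by
      refine integral_pos_of_integrable_nonneg_nonzero (x := 1) hcont hi (fun y => ?_) ?_
      · positivity
      · norm_num
    exact_mod_cast this.ne'
  -- For σ < 0 the map z ↦ iy₀ - σz is a dilation onto the same half-plane taking -1 to iy₀ + σ, so
  -- E σ has derivative g(σ + iy₀) at -1. On the axis E σ is a difference quotient of φ, which
  -- converges as σ → 0.
  set E : ℝ → ℂ → ℂ := fun σ z => (F (y₀ * Complex.I - σ * z) - φ y₀) / (-σ : ℂ) with hE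
  have hbound : ∀ σ : ℝ, σ < 0 → ∀ z, ‖E σ z‖ ≤ K * ‖z‖ := by
    intro σ hσ z
    have h1 := hF.norm_sub_le (y₀ * Complex.I - σ * z) (y₀ * Complex.I)
    simp only [sub_sub_cancel_left, norm_neg, norm_mul, Complex.norm_real] at h1
    simp only [hE, hφ, norm_div, norm_neg, Complex.norm_real]
    rw [div_le_iff₀ (norm_pos_iff.2 hσ.ne)]
    linarith
  have hcE : ∀ σ : ℝ, Continuous (E σ) := fun σ => by
    have := hF.continuous
    simp only [hE]
    fun_prop
  have hdE : ∀ σ : ℝ, σ < 0 → ∀ z : ℂ, z.re < 0 →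
      HasDerivAt (E σ) (g (y₀ * Complex.I - σ * z)) z := by
    intro σ hσ z hz
    have h1 : HasDerivAt (fun z : ℂ => y₀ * Complex.I - σ * z) (-σ : ℂ) z := by
      simpa using ((hasDerivAt_id z).const_mul (σ : ℂ)).const_sub (y₀ * Complex.I)
    have h2 := (hFg (y₀ * Complex.I - σ * z) (by simp; nlinarith)).comp z h1
    have h3 := (h2.sub_const (φ y₀)).div_const (-σ : ℂ)
    refine h3.congr_deriv ?_
    have : (σ : ℂ) ≠ 0 := by exact_mod_cast hσ.ne
    field_simp
  have hformula : ∀ σ : ℝ, σ < 0 → g (σ + y₀ * Complex.I)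
      = -(∫ y : ℝ, E σ (y * Complex.I) * (y * Complex.I / (1 + y ^ 2) ^ 2)) / c₀ := by
    intro σ hσ
    have h := deriv_neg_one_mul_integral (hcE σ)
      (fun z hz => (hdE σ hσ z hz).differentiableAt.differentiableWithinAt) (hbound σ hσ)
    rw [(hdE σ hσ (-1) (by simp)).deriv] at h
    rw [eq_div_iff hc0, ← h]
    congr 2
    ring
  have hlim : Tendsto (fun σ : ℝ =>
      ∫ y : ℝ, E σ (y * Complex.I) * (y * Complex.I / (1 + y ^ 2) ^ 2)) (𝓝[<] 0)
      (𝓝 (∫ y : ℝ, (y * deriv φ y₀) * (y * Complex.I / (1 + y ^ 2) ^ 2))) := by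
    refine tendsto_integral_filter_of_dominated_convergence (fun y => K * (1 + y ^ 2)⁻¹)
      (Eventually.of_forall fun σ => ?_) ?_ (hbase.const_mul _) (Eventually.of_forall fun y => ?_)
    · refine Continuous.aestronglyMeasurable ?_
      have := hcE σ
      refine Continuous.mul (by fun_prop) (Continuous.div (by fun_prop) (by fun_prop) fun y => ?_)
      exact_mod_cast (pow_pos (hpos y) 2).ne'
    · filter_upwards [self_mem_nhdsWithin] with σ hσ
      refine Eventually.of_forall fun y => ?_
      have h1 := hbound σ hσ (y * Complex.I)
      have h2 : ‖(1 + (y : ℂ) ^ 2) ^ 2‖ = (1 + y ^ 2) ^ 2 := by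
        rw [norm_pow, ← Complex.ofReal_pow, ← Complex.ofReal_one, ← Complex.ofReal_add,
          Complex.norm_real, Real.norm_of_nonneg (hpos y).le]
      simp only [norm_mul, norm_div, Complex.norm_real, Complex.norm_I, mul_one, h2] at h1 ⊢
      calc ‖E σ (y * Complex.I)‖ * (‖y‖ / (1 + y ^ 2) ^ 2)
          ≤ K * ‖y‖ * (‖y‖ / (1 + y ^ 2) ^ 2) := by gcongr
        _ = K * (y ^ 2 / (1 + y ^ 2) ^ 2) := by
            rw [Real.norm_eq_abs, ← sq_abs y]; ring
        _ ≤ K * ((1 + y ^ 2) / (1 + y ^ 2) ^ 2) := by gcongr; linarith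
        _ = K * (1 + y ^ 2)⁻¹ := by have := hpos y; field_simp
    · refine Tendsto.mul_const _ ?_
      have h1 : HasDerivAt (fun σ : ℝ => φ (y₀ - σ * y)) (-y * deriv φ y₀) 0 := by
        have h2 : HasDerivAt (fun σ : ℝ => y₀ - σ * y) (-y) 0 := by
          simpa using ((hasDerivAt_id (0 : ℝ)).mul_const y).const_sub y₀
        have h3 : HasDerivAt φ (deriv φ y₀) (y₀ - 0 * y) := by simpa using hy.hasDerivAt
        refine (h3.scomp (0 : ℝ) h2).congr_deriv ?_
        simp
      have h2 := (h1.tendsto_slope).mono_left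
        (nhdsWithin_mono (0 : ℝ) (fun σ (hσ : σ < 0) => hσ.ne))
      have h3 := h2.neg
      simp only [neg_mul, neg_neg] at h3
      refine h3.congr fun σ => ?_
      simp only [hE, hφ, slope, sub_zero, zero_mul, vsub_eq_sub, Complex.real_smul]
      push_cast
      rw [div_neg, div_eq_inv_mul]
      congr 5
      ring
  refine ⟨_, ((hlim.neg).div_const (c₀ : ℂ)).congr' ?_⟩
  filter_upwards [self_mem_nhdsWithin] with σ hσ
  exact (hformula σ hσ).symm

/-- **Fatou's theorem** for the left half-plane. -/
theorem IsHInfty.ae_exists_tendsto {g : ℂ → ℂ} (hg : IsHInfty g) :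
    ∀ᵐ y : ℝ, ∃ c, Tendsto (fun σ : ℝ => g (σ + y * Complex.I)) (𝓝[<] 0) (𝓝 c) := by
  obtain ⟨hd, K, hK⟩ := hg
  obtain ⟨F, hF⟩ := exists_primitive_leftHalfPlane hd
  have hopen : IsOpen {z : ℂ | z.re < 0} := isOpen_lt Complex.continuous_re continuous_const
  have hlip : LipschitzOnWith K.toNNReal F {z : ℂ | z.re < 0} := by
    refine Convex.lipschitzOnWith_of_nnnorm_hasDerivWithin_le (𝕜 := ℂ) (f' := g)
      (convex_halfSpace_re_lt 0) (fun z hz => (hF z hz).hasDerivWithinAt) fun z hz => ?_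
    rw [← NNReal.coe_le_coe]
    exact (hK z hz).trans (Real.le_coe_toNNReal K)
  -- The Lipschitz extension supplies values on the axis; agreement on the open half-plane preserves
  -- the derivative there.
  obtain ⟨F', hF', hEq⟩ := hlip.extend_finite_dimension
  have hF'g : ∀ z : ℂ, z.re < 0 → HasDerivAt F' (g z) z := fun z hz =>
    (hF z hz).congr_of_eventuallyEq ((hEq.eventuallyEq_of_mem (hopen.mem_nhds hz)).symm)
  have hI : LipschitzWith 1 fun y : ℝ => (y * Complex.I : ℂ) := by
    refine LipschitzWith.of_dist_le_mul fun x y => ?_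
    simp [dist_eq_norm, ← sub_mul, ← Complex.ofReal_sub]
  filter_upwards [(hF'.comp hI).ae_differentiableAt] with y hy
  exact exists_tendsto_of_differentiableAt_primitive hF' hF'g hy

theorem IsHInfty.exists_boundary {g : ℂ → ℂ} (hg : IsHInfty g) :
    ∃ b : Lp ℂ ∞ (volume : Measure ℝ), ∀ᵐ ξ : ℝ,
      Tendsto (fun σ : ℝ => g (σ + 2 * Real.pi * ξ * Complex.I)) (𝓝[<] 0) (𝓝 (b ξ)) := by
  obtain ⟨K, hK⟩ := hg.2
  have hlim : ∀ᵐ ξ : ℝ, ∃ c,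
      Tendsto (fun σ : ℝ => g (σ + 2 * Real.pi * ξ * Complex.I)) (𝓝[<] 0) (𝓝 c) := by
    have h := (Measure.quasiMeasurePreserving_smul (volume : Measure ℝ)
      (r := 2 * Real.pi) (by positivity)).ae hg.ae_exists_tendsto
    filter_upwards [h] with ξ hξ
    simpa using hξ
  -- A sequence of abscissae makes the limit function measurable; the full limit exists almost
  -- everywhere and must agree with it.
  set u : ℕ → ℝ := fun n => -1 / ((n : ℝ) + 1) with hu
  have hun : ∀ n, u n < 0 := fun n => div_neg_of_neg_of_pos (by norm_num) (by positivity)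
  have hu0 : Tendsto u atTop (𝓝[<] 0) := by
    refine tendsto_nhdsWithin_iff.2 ⟨?_, Eventually.of_forall hun⟩
    have := (tendsto_one_div_add_atTop_nhds_zero_nat (𝕜 := ℝ)).neg
    simpa [hu, neg_div] using this
  have hmeas : ∀ n, AEStronglyMeasurable
      (fun ξ : ℝ => g (u n + 2 * Real.pi * ξ * Complex.I)) volume := fun n => by
    refine Continuous.aestronglyMeasurable (hg.1.continuousOn.comp_continuous (by fun_prop) ?_)
    intro ξ
    simpa using hun n
  obtain ⟨b, hbm, hb⟩ := exists_stronglyMeasurable_limit_of_tendsto_ae hmeas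
    (by filter_upwards [hlim] with ξ ⟨c, hc⟩ using ⟨c, hc.comp hu0⟩)
  have hbK : ∀ᵐ ξ : ℝ, ‖b ξ‖ ≤ K := by
    filter_upwards [hb] with ξ hξ
    refine le_of_tendsto hξ.norm (Eventually.of_forall fun n => hK _ ?_)
    simpa using hun n
  have hbL : MemLp b ∞ (volume : Measure ℝ) :=
    memLp_top_of_bound hbm.aestronglyMeasurable K hbK
  refine ⟨hbL.toLp b, ?_⟩
  filter_upwards [hbL.coeFn_toLp, hb, hlim] with ξ h1 h2 ⟨c, hc⟩
  rw [h1, tendsto_nhds_unique h2 (hc.comp hu0)]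
  exact hc

theorem IsHInfty.tendsto_boundaryFunction {g : ℂ → ℂ} (hg : IsHInfty g) :
    ∀ᵐ ξ : ℝ, Tendsto (fun σ : ℝ => g (σ + 2 * Real.pi * ξ * Complex.I)) (𝓝[<] 0)
      (𝓝 (boundaryFunction g ξ)) := by
  rw [boundaryFunction, dif_pos hg.exists_boundary]
  exact hg.exists_boundary.choose_spec


/-! ### The Fourier transform on `L²(ℝ, E)` -/

theorem Real.continuous_fourier_of_integrable {E : Type*} [NormedAddCommGroup E]
    [NormedSpace ℂ E] {f : ℝ → E} (hf : Integrable f) :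
    Continuous (𝓕 f) :=
  VectorFourier.fourierIntegral_continuous Real.continuous_fourierChar continuous_inner hf

section Fourier

variable {E F : Type*} [NormedAddCommGroup E] [InnerProductSpace ℂ E] [CompleteSpace E]
  [NormedAddCommGroup F] [InnerProductSpace ℂ F] [CompleteSpace F]

/-- Schwartz functions include the smooth compactly supported ones. This is how the `L²` transforms,
known through their action as tempered distributions, are identified below. -/
theorem ae_eq_of_integral_schwartz_smul_eq {f h : ℝ → E} (hf : LocallyIntegrable f)
    (hh : LocallyIntegrable h)
    (heq : ∀ φ : SchwartzMap ℝ ℂ, ∫ x, φ x • f x = ∫ x, φ x • h x) : f =ᵐ[volume] h := by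
  refine ae_eq_of_integral_contDiff_smul_eq hf hh fun φ φ_smooth φ_cpt => ?_
  have h1 : HasCompactSupport (Complex.ofRealCLM ∘ φ) := φ_cpt.comp_left rfl
  have h2 := Complex.ofRealCLM.contDiff.comp φ_smooth
  simpa using heq (h1.toSchwartzMap h2)

theorem integral_schwartz_smul_fourier (f : Lp E 2 (volume : Measure ℝ)) (φ : SchwartzMap ℝ ℂ) :
    ∫ x, φ x • (𝓕 f : Lp E 2 (volume : Measure ℝ)) x = ∫ x, (𝓕 φ : SchwartzMap ℝ ℂ) x • f x := by
  have h := congrArg (fun u => u φ) (Lp.fourier_toTemperedDistribution_eq f)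
  simpa using h.symm

theorem integral_schwartz_smul_fourierInv (f : Lp E 2 (volume : Measure ℝ))
    (φ : SchwartzMap ℝ ℂ) : ∫ x, φ x • (𝓕⁻ f : Lp E 2 (volume : Measure ℝ)) x
      = ∫ x, (𝓕⁻ φ : SchwartzMap ℝ ℂ) x • f x := by
  have h := congrArg (fun u => u φ) (Lp.fourierInv_toTemperedDistribution_eq f)
  simpa using h.symm

theorem integral_smul_fourier {φ : ℝ → ℂ} {f : ℝ → E} (hφ : Integrable φ) (hf : Integrable f) :
    ∫ x, φ x • 𝓕 f x = ∫ x, 𝓕 φ x • f x := by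
  simpa using! (VectorFourier.integral_fourierIntegral_smul_eq_flip (L := innerₗ ℝ)
    Real.continuous_fourierChar continuous_inner hφ hf).symm

/-- On `L¹ ∩ L²`, the `L²` Fourier transform is given by the Fourier integral. -/
theorem fourier_toLp_ae_eq {f : ℝ → E} (h1 : Integrable f) (h2 : MemLp f 2) :
    (𝓕 (h2.toLp f) : Lp E 2 (volume : Measure ℝ)) =ᵐ[volume] 𝓕 f := by
  refine ae_eq_of_integral_schwartz_smul_eq ((Lp.memLp _).locallyIntegrable one_le_two)
    (Real.continuous_fourier_of_integrable h1).locallyIntegrable fun φ => ?_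
  rw [integral_schwartz_smul_fourier, integral_smul_fourier φ.integrable h1]
  refine integral_congr_ae ?_
  filter_upwards [h2.coeFn_toLp] with x hx
  rw [hx, SchwartzMap.fourier_coe]

/-- On `L¹ ∩ L²`, the inverse `L²` Fourier transform is given by the Fourier integral. -/
theorem fourierInv_toLp_ae_eq {f : ℝ → E} (h1 : Integrable f) (h2 : MemLp f 2) :
    (𝓕⁻ (h2.toLp f) : Lp E 2 (volume : Measure ℝ)) =ᵐ[volume] 𝓕⁻ f := by
  have hneg : 𝓕⁻ f = fun x => 𝓕 f (-x) := by
    ext x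
    exact Real.fourierInv_eq_fourier_neg f x
  have hc : Continuous (𝓕⁻ f) := by
    rw [hneg]
    exact (Real.continuous_fourier_of_integrable h1).comp continuous_neg
  refine ae_eq_of_integral_schwartz_smul_eq ((Lp.memLp _).locallyIntegrable one_le_two)
    hc.locallyIntegrable fun φ => ?_
  rw [integral_schwartz_smul_fourierInv]
  have hneg2 : ∀ x, (𝓕⁻ φ : SchwartzMap ℝ ℂ) x = 𝓕 (fun y => φ (-y)) x := fun x => by
    rw [SchwartzMap.fourierInv_coe, Real.fourierInv_eq_fourier_comp_neg]
  calc ∫ x, (𝓕⁻ φ : SchwartzMap ℝ ℂ) x • h2.toLp f x = ∫ x, 𝓕 (fun y => φ (-y)) x • f x := by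
        refine integral_congr_ae ?_
        filter_upwards [h2.coeFn_toLp] with x hx
        rw [hx, hneg2]
    _ = ∫ x, φ (-x) • 𝓕 f x := (integral_smul_fourier φ.integrable.comp_neg h1).symm
    _ = ∫ x, φ x • 𝓕⁻ f x := by
        rw [← integral_neg_eq_self, hneg]
        simp

/-- The `L²` Fourier transform commutes with bounded linear maps of the values. -/
theorem fourier_compLp (L : E →L[ℂ] F) (f : Lp E 2 (volume : Measure ℝ)) :
    𝓕 (L.compLp f) = L.compLp (𝓕 f) := by
  refine Lp.ext (ae_eq_of_integral_schwartz_smul_eq ((Lp.memLp _).locallyIntegrable one_le_two)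
    ((Lp.memLp _).locallyIntegrable one_le_two) fun φ => ?_)
  have hint : ∀ (ψ : SchwartzMap ℝ ℂ) (u : Lp E 2 (volume : Measure ℝ)),
      ∫ x, ψ x • (L.compLp u) x = L (∫ x, ψ x • u x) := fun ψ u => by
    have hi : Integrable fun x => ψ x • u x :=
      memLp_one_iff_integrable.1 ((Lp.memLp u).smul (ψ.memLp 2))
    rw [← ContinuousLinearMap.integral_comp_comm L hi]
    refine integral_congr_ae ?_
    filter_upwards [L.coeFn_compLp u] with x hx
    rw [hx, map_smul]
  rw [integral_schwartz_smul_fourier, hint, hint, integral_schwartz_smul_fourier]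

theorem fourierInv_compLp (L : E →L[ℂ] F) (f : Lp E 2 (volume : Measure ℝ)) :
    𝓕⁻ (L.compLp f) = L.compLp (𝓕⁻ f) := by
  have h := fourier_compLp L (𝓕⁻ f)
  rw [FourierTransform.fourier_fourierInv_eq] at h
  rw [← h, FourierTransform.fourierInv_fourier_eq]

end Fourier

/-! ### Boundary functions of bounded analytic functions -/

/-- The point `2πiξ` of the imaginary axis. -/
noncomputable def imagPoint (ξ : ℝ) : ℂ := 2 * Real.pi * ξ * Complex.I

@[fun_prop]
theorem continuous_imagPoint : Continuous imagPoint := by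
  unfold imagPoint
  fun_prop

theorem imagPoint_re (ξ : ℝ) : (imagPoint ξ).re = 0 := by simp [imagPoint]

theorem one_sub_ne_zero_of_re_nonpos {z : ℂ} (hz : z.re ≤ 0) : 1 - z ≠ 0 := fun h => by
  have : z = 1 := by linear_combination -h
  simp [this] at hz
  linarith

theorem one_sub_imagPoint_ne_zero (ξ : ℝ) : 1 - imagPoint ξ ≠ 0 :=
  one_sub_ne_zero_of_re_nonpos (imagPoint_re ξ).le

theorem norm_imagPoint_ge (ξ : ℝ) : ‖ξ‖ ≤ ‖imagPoint ξ‖ := by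
  have h : (1 : ℝ) ≤ 2 * Real.pi := by linarith [Real.pi_gt_three]
  simp only [imagPoint, norm_mul, Complex.norm_real, Complex.norm_I, mul_one, Complex.norm_ofNat,
    Real.norm_of_nonneg Real.pi_pos.le]
  nlinarith [norm_nonneg ξ]

theorem one_add_sq_le_norm_one_sub_imagPoint (ξ : ℝ) : 1 + ξ ^ 2 ≤ ‖1 - imagPoint ξ‖ ^ 2 := by
  refine le_trans ?_ (norm_one_sub_sq_ge (imagPoint_re ξ).le)
  have := norm_imagPoint_ge ξ
  rw [← sq_abs ξ, ← Real.norm_eq_abs]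
  gcongr

/-- The regularising factor 1/(1 - εw) turns the decay of g/(1 - w) into the quadratic decay that
Cauchy's theorem needs. -/
theorem norm_mul_one_sub_ge {w : ℂ} (hw : w.re ≤ 0) {ε : ℝ} (hε : 0 < ε) (hε1 : ε ≤ 1) :
    ε * (1 + ‖w‖ ^ 2) ≤ ‖(1 - w) * (1 - ε * w)‖ := by
  have h1 := norm_one_sub_sq_ge hw
  have h2 := norm_one_sub_sq_ge (z := ε * w) (by simp; nlinarith)
  rw [norm_mul, Complex.norm_real, Real.norm_of_nonneg hε.le] at h2
  refine le_of_sq_le_sq ?_ (norm_nonneg _)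
  rw [norm_mul, mul_pow, mul_pow]
  have h3 : ε ^ 2 * (1 + ‖w‖ ^ 2) ≤ 1 + (ε * ‖w‖) ^ 2 := by
    nlinarith [sq_nonneg ‖w‖]
  calc ε ^ 2 * (1 + ‖w‖ ^ 2) ^ 2 = (1 + ‖w‖ ^ 2) * (ε ^ 2 * (1 + ‖w‖ ^ 2)) := by ring
    _ ≤ _ := mul_le_mul h1 (h3.trans h2) (by positivity) (by positivity)

/-- The boundary function of `g(z) / ((1 - z) (1 - ε z))` is the inverse Fourier transform of a
function that vanishes on the negative half-line. -/
theorem IsHInfty.fourier_boundary_eq_zero {g : ℂ → ℂ} (hg : IsHInfty g) {b : ℝ → ℂ}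
    (hb : ∀ᵐ ξ : ℝ, Tendsto (fun σ : ℝ => g (σ + imagPoint ξ)) (𝓝[<] 0) (𝓝 (b ξ)))
    {ε : ℝ} (hε : 0 < ε) (hε1 : ε ≤ 1) {τ : ℝ} (hτ : τ ≤ 0) :
    𝓕 (fun ξ : ℝ => b ξ / ((1 - imagPoint ξ) * (1 - ε * imagPoint ξ))) τ = 0 := by
  obtain ⟨K, hK⟩ := hg.2
  have hK0 : 0 ≤ K := (norm_nonneg _).trans (hK (-1) (by simp))
  -- At w = 2πiξ the exponential is the Fourier kernel at τ; for τ ≤ 0 it is bounded by 1 on the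
  -- left half-plane. Cauchy's theorem is applied on the lines Re w = σ < 0, and then σ → 0.
  set Φ : ℂ → ℂ := fun w => g w / ((1 - w) * (1 - ε * w)) * Complex.exp (-τ * w) with hΦ
  have hne : ∀ w : ℂ, w.re ≤ 0 → (1 - w) * (1 - ε * w) ≠ 0 := fun w hw =>
    norm_pos_iff.1 (lt_of_lt_of_le (by positivity) (norm_mul_one_sub_ge hw hε hε1))
  have hΦd : DifferentiableOn ℂ Φ {z | z.re < 0} :=
    (hg.1.div (by fun_prop) fun w (hw : w.re < 0) => hne w hw.le).mul (by fun_prop)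
  have hexp : ∀ w : ℂ, w.re ≤ 0 → ‖Complex.exp (-τ * w)‖ ≤ 1 := fun w hw => by
    rw [Complex.norm_exp]
    simp
    nlinarith
  have hΦb : ∀ w : ℂ, w.re < 0 → ‖Φ w‖ ≤ K / ε / (1 + ‖w‖ ^ 2) := fun w hw => by
    rw [hΦ]
    simp only [norm_mul _ (Complex.exp _), norm_div]
    calc _ ≤ K / (ε * (1 + ‖w‖ ^ 2)) * 1 := by
          gcongr
          · exact hK w hw
          · exact norm_mul_one_sub_ge hw.le hε hε1
          · exact hexp w hw.le
      _ = _ := by rw [mul_one, div_div]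
  have hshift : ∀ {σ : ℝ} {z : ℂ}, σ < 0 → z.re ≤ 0 → ‖z‖ ≤ ‖z + σ‖ := fun {σ z} hσ hz => by
    refine le_of_sq_le_sq ?_ (norm_nonneg _)
    rw [← Complex.normSq_eq_norm_sq, ← Complex.normSq_eq_norm_sq, Complex.normSq_apply,
      Complex.normSq_apply]
    simp
    nlinarith
  have hΦσ : ∀ {σ : ℝ} {z : ℂ}, σ < 0 → z.re ≤ 0 → ‖Φ (z + σ)‖ ≤ K / ε / (1 + ‖z‖ ^ 2) :=
    fun {σ z} hσ hz => by
      refine (hΦb _ (by simp; linarith)).trans ?_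
      have := hshift hσ hz
      gcongr
  have hcont : ∀ {σ : ℝ}, σ < 0 → ContinuousOn (fun z : ℂ => Φ (z + σ)) {z | z.re ≤ 0} :=
    fun {σ} hσ => hΦd.continuousOn.comp (by fun_prop) fun z (hz : z.re ≤ 0) =>
      show (z + σ).re < 0 by simp; linarith
  have hbase : Integrable fun y : ℝ => K / ε / (1 + y ^ 2) := by
    simpa [div_eq_mul_inv] using integrable_inv_one_add_sq.const_mul (K / ε)
  have hzero : ∀ σ : ℝ, σ < 0 → ∫ ξ : ℝ, Φ (σ + imagPoint ξ) = 0 := by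
    intro σ hσ
    have h := integral_imaginaryAxis_eq_zero (H := fun z => Φ (z + σ)) (R₀ := 1) (M := K / ε)
      (hcont hσ) (hΦd.comp (by fun_prop) fun z (hz : z.re < 0) =>
        show (z + σ).re < 0 by simp; linarith) ?_ ?_
    · have h2 := Measure.integral_comp_mul_left (fun y : ℝ => Φ (y * Complex.I + σ)) (2 * Real.pi)
      rw [h, smul_zero] at h2
      rw [← h2]
      refine integral_congr_ae (Eventually.of_forall fun ξ => ?_)
      simp [imagPoint, add_comm]
    · refine hbase.mono' ?_ (Eventually.of_forall fun y => ?_)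
      · exact ((hcont hσ).comp_continuous (by fun_prop) fun y => by simp).aestronglyMeasurable
      · refine (hΦσ hσ (by simp)).trans (le_of_eq ?_)
        simp
    · intro z hz hz1
      refine (hΦσ hσ hz).trans ?_
      have : 0 < ‖z‖ := by linarith
      gcongr
      linarith
  have hlim : Tendsto (fun σ : ℝ => ∫ ξ : ℝ, Φ (σ + imagPoint ξ)) (𝓝[<] 0)
      (𝓝 (∫ ξ : ℝ, b ξ / ((1 - imagPoint ξ) * (1 - ε * imagPoint ξ))
        * Complex.exp (-τ * imagPoint ξ))) := by
    refine tendsto_integral_filter_of_dominated_convergence (fun y => K / ε / (1 + y ^ 2))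
      ?_ ?_ hbase ?_
    · filter_upwards [self_mem_nhdsWithin] with σ hσ
      have : Continuous fun ξ : ℝ => Φ (imagPoint ξ + σ) :=
        (hcont hσ).comp_continuous (by fun_prop) fun ξ => (imagPoint_re ξ).le
      simpa only [add_comm] using this.aestronglyMeasurable
    · filter_upwards [self_mem_nhdsWithin] with σ hσ
      refine Eventually.of_forall fun ξ => ?_
      rw [add_comm]
      refine (hΦσ hσ (imagPoint_re ξ).le).trans ?_
      rw [← sq_abs ξ, ← Real.norm_eq_abs]
      have := norm_imagPoint_ge ξ
      gcongr
    · filter_upwards [hb] with ξ hξ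
      have hid : Tendsto (fun σ : ℝ => (σ + imagPoint ξ : ℂ)) (𝓝[<] 0) (𝓝 (imagPoint ξ)) := by
        have : Continuous fun σ : ℝ => (σ + imagPoint ξ : ℂ) := by fun_prop
        simpa using (this.tendsto 0).mono_left nhdsWithin_le_nhds
      refine (hξ.div (Tendsto.mul (hid.const_sub 1) ((hid.const_mul _).const_sub 1))
        (hne _ (imagPoint_re ξ).le)).mul ?_
      exact (Complex.continuous_exp.tendsto _).comp (hid.const_mul _)
  rw [Real.fourier_real_eq_integral_exp_smul]
  have h0 := tendsto_nhds_unique hlim (tendsto_const_nhds.congr' (by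
    filter_upwards [self_mem_nhdsWithin] with σ hσ using (hzero σ hσ).symm))
  rw [← h0]
  refine integral_congr_ae (Eventually.of_forall fun ξ => ?_)
  simp only [smul_eq_mul]
  rw [mul_comm]
  congr 2
  simp [imagPoint]
  ring

theorem IsHInfty.exists_boundary_bound {g : ℂ → ℂ} (hg : IsHInfty g) {b : ℝ → ℂ}
    (hb : ∀ᵐ ξ : ℝ, Tendsto (fun σ : ℝ => g (σ + imagPoint ξ)) (𝓝[<] 0) (𝓝 (b ξ))) :
    ∃ K : ℝ, 0 ≤ K ∧ ∀ᵐ ξ : ℝ, ‖b ξ‖ ≤ K := by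
  obtain ⟨K, hK⟩ := hg.2
  refine ⟨K, (norm_nonneg _).trans (hK (-1) (by simp)), ?_⟩
  filter_upwards [hb] with ξ hξ
  refine le_of_tendsto hξ.norm ?_
  filter_upwards [self_mem_nhdsWithin] with σ (hσ : σ < 0)
  exact hK _ (by simpa [imagPoint_re] using hσ)

theorem memLp_div_one_sub_imagPoint {b : ℝ → ℂ} (hbm : AEStronglyMeasurable b volume) {K : ℝ}
    (hbK : ∀ᵐ ξ : ℝ, ‖b ξ‖ ≤ K) : MemLp (fun ξ => b ξ / (1 - imagPoint ξ)) 2 := by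
  have hm : AEStronglyMeasurable (fun ξ => b ξ / (1 - imagPoint ξ)) volume := by
    simp only [div_eq_mul_inv]
    exact hbm.mul (Continuous.aestronglyMeasurable (Continuous.inv₀ (by fun_prop)
      one_sub_imagPoint_ne_zero))
  rw [← memLp_norm_iff hm, memLp_two_iff_integrable_sq hm.norm]
  refine (integrable_inv_one_add_sq.const_mul (K ^ 2)).mono' (hm.norm.pow 2) ?_
  filter_upwards [hbK] with ξ hξ
  have h1 := one_add_sq_le_norm_one_sub_imagPoint ξ
  rw [norm_pow, norm_norm, norm_div, div_pow, div_eq_mul_inv]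
  gcongr

/-- With the factor 1/(1 - εs) inserted, the symbol is integrable and the transform can be moved
onto it. The transformed symbol vanishes on (-∞, 0] and v on (0,∞), so the integral is zero; then ε
→ 0. -/
theorem integral_boundary_smul_fourier_eq_zero {E : Type*} [NormedAddCommGroup E]
    [InnerProductSpace ℂ E] [CompleteSpace E] {g : ℂ → ℂ} (hg : IsHInfty g) {b : ℝ → ℂ}
    (hbm : AEStronglyMeasurable b volume)
    (hb : ∀ᵐ ξ : ℝ, Tendsto (fun σ : ℝ => g (σ + imagPoint ξ)) (𝓝[<] 0) (𝓝 (b ξ)))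
    {v : ℝ → E} (h1 : Integrable v) (h2 : MemLp v 2) (hv : ∀ᵐ t : ℝ, 0 < t → v t = 0) :
    ∫ ξ : ℝ, (b ξ / (1 - imagPoint ξ)) • 𝓕 v ξ = 0 := by
  obtain ⟨K, hK0, hbK⟩ := hg.exists_boundary_bound hb
  have hFv : MemLp (𝓕 v) 2 := (memLp_congr_ae (fourier_toLp_ae_eq h1 h2)).1 (Lp.memLp _)
  have hG := memLp_div_one_sub_imagPoint hbm hbK
  set u : ℕ → ℝ := fun n => 1 / ((n : ℝ) + 1) with hu
  have hu0 : Tendsto u atTop (𝓝 0) := tendsto_one_div_add_atTop_nhds_zero_nat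
  have hup : ∀ n, 0 < u n := fun n => by positivity
  have hu1 : ∀ n, u n ≤ 1 := fun n => by
    rw [hu]
    exact (div_le_one (by positivity)).2 (by linarith [(Nat.cast_nonneg n : (0 : ℝ) ≤ n)])
  have hcu : ∀ n, Continuous fun ξ : ℝ => ((1 - imagPoint ξ) * (1 - u n * imagPoint ξ))⁻¹ :=
    fun n => Continuous.inv₀ (by fun_prop) fun ξ => norm_pos_iff.1 (lt_of_lt_of_le
      (by have := hup n; positivity) (norm_mul_one_sub_ge (imagPoint_re ξ).le (hup n) (hu1 n)))
  have hm : ∀ n, AEStronglyMeasurable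
      (fun ξ => b ξ / ((1 - imagPoint ξ) * (1 - u n * imagPoint ξ))) volume := fun n => by
    simp only [div_eq_mul_inv]
    exact hbm.mul (hcu n).aestronglyMeasurable
  have hint : ∀ n, Integrable fun ξ => b ξ / ((1 - imagPoint ξ) * (1 - u n * imagPoint ξ)) := by
    intro n
    refine (integrable_inv_one_add_sq.const_mul (K / u n)).mono' (hm n) ?_
    filter_upwards [hbK] with ξ hξ
    have h3 := norm_mul_one_sub_ge (imagPoint_re ξ).le (hup n) (hu1 n)
    have h4 := norm_imagPoint_ge ξ
    have := hup n
    rw [norm_div]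
    calc _ ≤ K / (u n * (1 + ‖ξ‖ ^ 2)) := by
          gcongr
          exact le_trans (by gcongr) h3
      _ = _ := by rw [Real.norm_eq_abs, sq_abs]; field_simp
  have hzero : ∀ n,
      ∫ ξ : ℝ, (b ξ / ((1 - imagPoint ξ) * (1 - u n * imagPoint ξ))) • 𝓕 v ξ = 0 := fun n => by
    rw [integral_smul_fourier (hint n) h1]
    refine integral_eq_zero_of_ae ?_
    filter_upwards [hv] with t ht
    rcases le_or_gt t 0 with h | h
    · rw [hg.fourier_boundary_eq_zero hb (hup n) (hu1 n) h, zero_smul, Pi.zero_apply]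
    · rw [ht h, smul_zero, Pi.zero_apply]
  have hlim : Tendsto (fun n =>
      ∫ ξ : ℝ, (b ξ / ((1 - imagPoint ξ) * (1 - u n * imagPoint ξ))) • 𝓕 v ξ) atTop
      (𝓝 (∫ ξ : ℝ, (b ξ / (1 - imagPoint ξ)) • 𝓕 v ξ)) := by
    -- The limit integrand dominates, since |1 - εs| ≥ 1 on the axis; it is integrable as a product
    -- of two `L²` functions.
    refine tendsto_integral_of_dominated_convergence
      (fun ξ => ‖(b ξ / (1 - imagPoint ξ)) • 𝓕 v ξ‖) (fun n => (hm n).smul hFv.1)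
      (memLp_one_iff_integrable.1 (hFv.smul hG)).norm (fun n => Eventually.of_forall fun ξ => ?_)
      (Eventually.of_forall fun ξ => ?_)
    · rw [norm_smul, norm_smul, ← div_div, norm_div (b ξ / _)]
      have h3 := norm_one_sub_sq_ge (z := u n * imagPoint ξ) (by simp [imagPoint_re])
      have h4 : 1 ≤ ‖1 - u n * imagPoint ξ‖ := by
        refine le_of_sq_le_sq ?_ (norm_nonneg _)
        linarith [sq_nonneg ‖u n * imagPoint ξ‖]
      gcongr
      exact div_le_self (norm_nonneg _) h4
    · refine Tendsto.smul_const ?_ _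
      have h3 : Tendsto (fun n => (1 - imagPoint ξ) * (1 - u n * imagPoint ξ)) atTop
          (𝓝 ((1 - imagPoint ξ) * (1 - (0 : ℝ) * imagPoint ξ))) :=
        ((((Complex.continuous_ofReal.tendsto _).comp hu0).mul_const _).const_sub 1).const_mul _
      simp only [Complex.ofReal_zero, zero_mul, sub_zero, mul_one] at h3
      exact tendsto_const_nhds.div h3 (one_sub_imagPoint_ne_zero ξ)
  exact tendsto_nhds_unique hlim (by simp only [hzero]; exact tendsto_const_nhds)


/-! ### Toeplitz operators -/

section Toeplitz

variable {H : Type*} [NormedAddCommGroup H] [InnerProductSpace ℂ H]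

theorem extendZero_ae_eq (f : Lp H 2 (volume.restrict (Ioi (0 : ℝ)))) :
    extendZero H f =ᵐ[volume] (Ioi (0 : ℝ)).indicator f := by
  have h : extendZero H f = ((memLp_indicator_iff_restrict measurableSet_Ioi).2
    (Lp.memLp f)).toLp ((Ioi (0 : ℝ)).indicator f) := rfl
  rw [h]
  exact MemLp.coeFn_toLp _

/-- Multiplication by the boundary function of `g`. -/
noncomputable def boundaryMul (H : Type*) [NormedAddCommGroup H] [InnerProductSpace ℂ H]
    (g : ℂ → ℂ) : Lp H 2 (volume : Measure ℝ) →L[ℂ] Lp H 2 (volume : Measure ℝ) :=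
  (ContinuousLinearMap.lsmul ℂ ℂ).holderL volume ∞ 2 2 (boundaryFunction g)

theorem boundaryMul_ae_eq (g : ℂ → ℂ) (f : Lp H 2 (volume : Measure ℝ)) :
    boundaryMul H g f =ᵐ[volume] fun ξ => boundaryFunction g ξ • f ξ :=
  (ContinuousLinearMap.lsmul ℂ ℂ).coeFn_holder (boundaryFunction g) f

variable [CompleteSpace H]

theorem laplace_apply (f : Lp H 2 (volume.restrict (Ioi (0 : ℝ)))) :
    laplace H f = 𝓕 (extendZero H f) := rfl

/-- The composition `𝔏⁻¹ Π 𝓕` of the inverse Laplace transform, the orthogonal projection onto the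
Hardy space and the Fourier transform is the restriction to the positive half-line. -/
theorem laplaceEquiv_symm_orthogonalProjectionOnto_fourier (V : Lp H 2 (volume : Measure ℝ)) :
    (laplaceEquiv H).symm ((hardySpace H).orthogonalProjectionOnto (𝓕 V))
      = ((Lp.memLp V).restrict (Ioi (0 : ℝ))).toLp V := by
  set R := ((Lp.memLp V).restrict (Ioi (0 : ℝ))).toLp V with hR
  rw [LinearIsometryEquiv.symm_apply_eq]
  apply Subtype.ext
  rw [← Submodule.starProjection_apply]
  refine Submodule.eq_starProjection_of_mem_of_inner_eq_zero (laplaceEquiv H R).2 ?_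
  rintro _ ⟨φ, rfl⟩
  have h1 : ((laplaceEquiv H R : hardySpace H) : Lp H 2 (volume : Measure ℝ))
      = 𝓕 (extendZero H R) := rfl
  have h2 : (laplace H).toLinearMap φ = 𝓕 (extendZero H φ) := rfl
  have h3 : 𝓕 V - 𝓕 (extendZero H R) = 𝓕 (V - extendZero H R) :=
    ((Lp.fourierTransformₗᵢ ℝ H).map_sub _ _).symm
  -- By Plancherel, orthogonality to the Hardy space reduces to disjoint supports: V minus its
  -- truncation lives on (-∞, 0], the test function on (0,∞).
  rw [h1, h2, h3, Lp.inner_fourier_eq, L2.inner_def]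
  refine integral_eq_zero_of_ae ?_
  have hRV := (ae_restrict_iff' measurableSet_Ioi).1
    (((Lp.memLp V).restrict (Ioi (0 : ℝ))).coeFn_toLp)
  filter_upwards [Lp.coeFn_sub V (extendZero H R), extendZero_ae_eq R, extendZero_ae_eq φ, hRV]
    with t h4 h5 h6 h7
  rw [h4, h6, Pi.sub_apply, h5]
  by_cases ht : t ∈ Ioi (0 : ℝ)
  · rw [indicator_of_mem ht, hR, h7 ht, sub_self, inner_zero_left, Pi.zero_apply]
  · rw [indicator_of_notMem ht (f := (φ : ℝ → H)), inner_zero_right, Pi.zero_apply]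

theorem toeplitz_ae_eq (g : ℂ → ℂ) (f : Lp H 2 (volume.restrict (Ioi (0 : ℝ)))) :
    toeplitz H g f =ᵐ[volume.restrict (Ioi 0)]
      (𝓕⁻ (boundaryMul H g (laplace H f)) : Lp H 2 (volume : Measure ℝ)) := by
  have h := laplaceEquiv_symm_orthogonalProjectionOnto_fourier
    (𝓕⁻ (boundaryMul H g (laplace H f)) : Lp H 2 (volume : Measure ℝ))
  rw [FourierTransform.fourier_fourierInv_eq] at h
  have h2 : toeplitz H g f = _ := h
  rw [h2]
  exact MemLp.coeFn_toLp _

/-- Toeplitz operators with scalar symbol commute with bounded linear maps of the values. -/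
theorem toeplitz_compLp {E : Type*} [NormedAddCommGroup E] [InnerProductSpace ℂ E]
    [CompleteSpace E] (g : ℂ → ℂ) (L : H →L[ℂ] E) (f : Lp H 2 (volume.restrict (Ioi (0 : ℝ)))) :
    toeplitz E g (L.compLp f) =ᵐ[volume.restrict (Ioi 0)] fun t => L (toeplitz H g f t) := by
  have hext : extendZero E (L.compLp f) = L.compLp (extendZero H f) := by
    refine Lp.ext ?_
    filter_upwards [extendZero_ae_eq (L.compLp f), L.coeFn_compLp (extendZero H f),
      extendZero_ae_eq f, (ae_restrict_iff' measurableSet_Ioi).1 (L.coeFn_compLp f)]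
      with t h1 h2 h3 h4
    rw [h1, h2, h3]
    by_cases ht : t ∈ Ioi (0 : ℝ)
    · rw [indicator_of_mem ht, indicator_of_mem ht, h4 ht]
    · rw [indicator_of_notMem ht, indicator_of_notMem ht, map_zero]
  have hmul : ∀ V : Lp H 2 (volume : Measure ℝ),
      boundaryMul E g (L.compLp V) = L.compLp (boundaryMul H g V) := fun V => by
    refine Lp.ext ?_
    filter_upwards [boundaryMul_ae_eq g (L.compLp V), L.coeFn_compLp V,
      L.coeFn_compLp (boundaryMul H g V), boundaryMul_ae_eq g V] with ξ h1 h2 h3 h4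
    rw [h1, h2, h3, h4, map_smul]
  have h1 := toeplitz_ae_eq g (L.compLp f)
  rw [laplace_apply, hext, fourier_compLp, hmul, fourierInv_compLp] at h1
  have h2 := L.coeFn_compLp (𝓕⁻ (boundaryMul H g (laplace H f)) : Lp H 2 (volume : Measure ℝ))
  filter_upwards [h1, ae_restrict_of_ae h2, toeplitz_ae_eq g f] with t h3 h4 h5
  rw [h3, h5, ← h4]
  rfl

end Toeplitz

/-! ### The symbol `g(s) / (1 - s)` -/

theorem IsHInfty.tendsto_boundaryFunction_imagPoint {g : ℂ → ℂ} (hg : IsHInfty g) :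
    ∀ᵐ ξ : ℝ, Tendsto (fun σ : ℝ => g (σ + imagPoint ξ)) (𝓝[<] 0) (𝓝 (boundaryFunction g ξ)) :=
  hg.tendsto_boundaryFunction

/-- The function `g(s) / (1 - s)` on the imaginary axis. -/
noncomputable def boundaryResolvent (g : ℂ → ℂ) (ξ : ℝ) : ℂ :=
  boundaryFunction g ξ / (1 - imagPoint ξ)

theorem IsHInfty.memLp_boundaryResolvent {g : ℂ → ℂ} (hg : IsHInfty g) :
    MemLp (boundaryResolvent g) 2 :=
  let ⟨_, _, hK⟩ := hg.exists_boundary_bound hg.tendsto_boundaryFunction_imagPoint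
  memLp_div_one_sub_imagPoint (Lp.aestronglyMeasurable _) hK

theorem IsHInfty.integral_boundaryResolvent_smul_fourier_eq_zero {E : Type*}
    [NormedAddCommGroup E] [InnerProductSpace ℂ E] [CompleteSpace E] {g : ℂ → ℂ}
    (hg : IsHInfty g) {v : ℝ → E} (h1 : Integrable v) (h2 : MemLp v 2)
    (hv : ∀ᵐ t : ℝ, 0 < t → v t = 0) : ∫ ξ : ℝ, boundaryResolvent g ξ • 𝓕 v ξ = 0 :=
  integral_boundary_smul_fourier_eq_zero hg (Lp.aestronglyMeasurable _)
    hg.tendsto_boundaryFunction_imagPoint h1 h2 hv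

/-- The inverse Fourier transform of `g(s) / (1 - s)` vanishes on the positive half-line. -/
theorem IsHInfty.fourierInv_boundaryResolvent_ae_eq_zero {g : ℂ → ℂ} (hg : IsHInfty g) :
    (𝓕⁻ (hg.memLp_boundaryResolvent.toLp _) : Lp ℂ 2 (volume : Measure ℝ))
      =ᵐ[volume.restrict (Ioi 0)] 0 := by
  refine (ae_restrict_iff' measurableSet_Ioi).2
    (isOpen_Ioi.ae_eq_zero_of_integral_contDiff_smul_eq_zero
      (((Lp.memLp _).locallyIntegrable one_le_two).locallyIntegrableOn _)
      fun φ φ_smooth φ_cpt φ_supp => ?_)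
  have h1 : HasCompactSupport (Complex.ofRealCLM ∘ φ) := φ_cpt.comp_left rfl
  have h2 := Complex.ofRealCLM.contDiff.comp φ_smooth
  set ψ := h1.toSchwartzMap h2 with hψ
  have h3 : ∀ t, φ t • (𝓕⁻ (hg.memLp_boundaryResolvent.toLp _) : Lp ℂ 2 (volume : Measure ℝ)) t
      = ψ t • (𝓕⁻ (hg.memLp_boundaryResolvent.toLp _) : Lp ℂ 2 (volume : Measure ℝ)) t :=
    fun t => by simp [hψ]
  simp only [h3]
  rw [integral_schwartz_smul_fourierInv]
  have hneg : MeasurePreserving (fun t : ℝ => -t) volume volume :=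
    Measure.measurePreserving_neg volume
  -- The inverse transform of ψ is the transform of its reflection, which vanishes on the positive
  -- half-line.
  have h4 := hg.integral_boundaryResolvent_smul_fourier_eq_zero (v := fun t => ψ (-t))
    ψ.integrable.comp_neg ((ψ.memLp 2).comp_measurePreserving hneg)
    (Eventually.of_forall fun t ht => by
      have : φ (-t) = 0 := by
        by_contra h
        have := φ_supp (subset_tsupport φ (Function.mem_support.2 h))
        simp only [mem_Ioi] at this
        linarith
      simp [hψ, this])
  rw [← h4]
  refine integral_congr_ae ?_
  filter_upwards [hg.memLp_boundaryResolvent.coeFn_toLp] with ξ hξ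
  rw [hξ, SchwartzMap.fourierInv_coe, Real.fourierInv_eq_fourier_comp_neg, smul_eq_mul,
    smul_eq_mul, mul_comm]


/-! ### Orbits of exponentially stable semigroups -/

namespace C0Semigroup

variable {X : Type*} [NormedAddCommGroup X] [NormedSpace ℂ X] (T : C0Semigroup X)

theorem continuous_orbit_toNNReal (x : X) : Continuous fun t : ℝ => T.op t.toNNReal x :=
  (T.continuous_orbit x).comp continuous_real_toNNReal

theorem op_add_apply (s t : ℝ≥0) (x : X) : T.op (s + t) x = T.op s (T.op t x) := by
  rw [T.op_add]
  rfl

theorem op_toNNReal_add_apply {s t : ℝ} (hs : 0 ≤ s) (ht : 0 ≤ t) (x : X) :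
    T.op (s + t).toNNReal x = T.op s.toNNReal (T.op t.toNNReal x) := by
  rw [Real.toNNReal_add hs ht, op_add_apply]

theorem tendsto_generator (x : T.generator.domain) :
    Tendsto (fun h : ℝ => (h : ℂ)⁻¹ • (T.op h.toNNReal x - x)) (𝓝[>] 0)
      (𝓝 (T.generator x)) := by
  obtain ⟨z, hz⟩ := x.2
  have h : T.generator x = z := hz.limUnder_eq
  rw [h]
  exact hz

theorem generator_domainOrbit (x : T.generator.domain) (t : ℝ) :
    T.generator (T.domainOrbit x t) = T.op t.toNNReal (T.generator x) := by
  refine tendsto_nhds_unique (T.tendsto_generator (T.domainOrbit x t)) ?_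
  refine (((T.op t.toNNReal).continuous.tendsto _).comp (T.tendsto_generator x)).congr fun h => ?_
  have hc : T.op t.toNNReal (T.op h.toNNReal x) = T.op h.toNNReal (T.op t.toNNReal x) := by
    rw [← op_add_apply, ← op_add_apply, add_comm]
  simp only [Function.comp_apply, map_smul, map_sub, hc]
  rfl

/-- The definition of the generator gives right derivatives directly, and these suffice for the
fundamental theorem of calculus. -/
theorem hasDerivWithinAt_orbit (x : T.generator.domain) {t : ℝ} (ht : 0 ≤ t) :
    HasDerivWithinAt (fun t : ℝ => T.op t.toNNReal x) (T.op t.toNNReal (T.generator x))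
      (Ioi t) t := by
  rw [hasDerivWithinAt_iff_tendsto_slope' (by simp)]
  have h1 := T.tendsto_generator (T.domainOrbit x t)
  rw [generator_domainOrbit] at h1
  have h2 : Tendsto (fun r : ℝ => r - t) (𝓝[>] t) (𝓝[>] 0) := by
    refine tendsto_nhdsWithin_iff.2 ⟨?_, ?_⟩
    · have : Continuous fun r : ℝ => r - t := by fun_prop
      simpa using (this.tendsto t).mono_left nhdsWithin_le_nhds
    · filter_upwards [self_mem_nhdsWithin] with r (hr : t < r)
      simpa using hr
  refine (h1.comp h2).congr' ?_
  filter_upwards [self_mem_nhdsWithin] with r (hr : t < r)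
  have h3 : T.op r.toNNReal x = T.op (r - t).toNNReal (T.op t.toNNReal x) := by
    rw [← T.op_toNNReal_add_apply (by linarith) ht, sub_add_cancel]
  rw [Function.comp_apply, slope, vsub_eq_sub, h3, ← Complex.ofReal_inv, Complex.coe_smul]
  rfl

variable {T} (hT : T.ExponentiallyStable)
include hT

theorem ExponentiallyStable.integrableOn_orbit (x : X) :
    IntegrableOn (fun t : ℝ => T.op t.toNNReal x) (Ioi 0) := by
  obtain ⟨M, ε, hε, hM⟩ := hT
  refine Integrable.mono' (g := fun t => M * ‖x‖ * Real.exp (-ε * t))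
    ((integrableOn_exp_mul_Ioi (by linarith) 0).const_mul _)
    (T.continuous_orbit_toNNReal x).aestronglyMeasurable ?_
  filter_upwards [ae_restrict_mem measurableSet_Ioi] with t (ht : 0 < t)
  have h1 := hM t.toNNReal
  rw [Real.coe_toNNReal t ht.le] at h1
  calc _ ≤ ‖T.op t.toNNReal‖ * ‖x‖ := (T.op t.toNNReal).le_opNorm x
    _ ≤ M * Real.exp (-ε * t) * ‖x‖ := by gcongr
    _ = _ := by ring

theorem ExponentiallyStable.tendsto_orbit (x : X) :
    Tendsto (fun t : ℝ => T.op t.toNNReal x) atTop (𝓝 0) := by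
  obtain ⟨M, ε, hε, hM⟩ := hT
  have h : Tendsto (fun t : ℝ => M * Real.exp (-ε * t) * ‖x‖) atTop (𝓝 (M * 0 * ‖x‖)) :=
    ((Real.tendsto_exp_atBot.comp
      (tendsto_id.const_mul_atTop_of_neg (by linarith))).const_mul M).mul_const _
  rw [mul_zero, zero_mul] at h
  refine squeeze_zero_norm' ?_ h
  filter_upwards [eventually_ge_atTop 0] with t ht
  have h1 := hM t.toNNReal
  rw [Real.coe_toNNReal t ht] at h1
  exact ((T.op t.toNNReal).le_opNorm x).trans (by gcongr)

omit hT

/-- The orbit of `x`, extended by zero to the negative half-line. -/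
noncomputable def zeroOrbit (T : C0Semigroup X) (x : X) : ℝ → X :=
  (Ioi (0 : ℝ)).indicator fun t => T.op t.toNNReal x

include hT

theorem ExponentiallyStable.integrable_zeroOrbit (x : X) : Integrable (T.zeroOrbit x) :=
  (integrable_indicator_iff measurableSet_Ioi).2 (hT.integrableOn_orbit x)

theorem ExponentiallyStable.memLp_zeroOrbit (x : X) : MemLp (T.zeroOrbit x) 2 :=
  (memLp_indicator_iff_restrict measurableSet_Ioi).2 (hT.memLp_orbit (.id ℂ X) x)

/-- Integrate the derivative e^{-st}(T(t)Ax - s T(t)x) of e^{-st}T(t)x over (0, R); stability kills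
the boundary term as R → ∞. -/
theorem ExponentiallyStable.fourier_zeroOrbit_generator [CompleteSpace X]
    (x : T.generator.domain) (ξ : ℝ) :
    𝓕 (T.zeroOrbit (T.generator x)) ξ = imagPoint ξ • 𝓕 (T.zeroOrbit (x : X)) ξ - (x : X) := by
  set e : ℝ → ℂ := fun t => Complex.exp (-imagPoint ξ * t) with he
  have hF : ∀ z : X, 𝓕 (T.zeroOrbit z) ξ = ∫ t in Ioi 0, e t • T.op t.toNNReal z := fun z => by
    rw [Real.fourier_real_eq_integral_exp_smul, ← integral_indicator measurableSet_Ioi]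
    refine integral_congr_ae (Eventually.of_forall fun t => ?_)
    by_cases ht : t ∈ Ioi (0 : ℝ)
    · simp only [zeroOrbit, indicator_of_mem ht, he]
      congr 2
      simp [imagPoint]
      ring
    · simp only [zeroOrbit, indicator_of_notMem ht, smul_zero]
  have hec : Continuous e := by fun_prop
  have hen : ∀ t, ‖e t‖ = 1 := fun t => by
    rw [he]
    simp [Complex.norm_exp, imagPoint_re]
  have hed : ∀ t, HasDerivAt e (-imagPoint ξ * e t) t := fun t => by
    have h1 : HasDerivAt (fun t : ℝ => -imagPoint ξ * (t : ℂ)) (-imagPoint ξ) t := by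
      simpa using (Complex.ofRealCLM.hasDerivAt (x := t)).const_mul (-imagPoint ξ)
    exact h1.cexp.congr_deriv (by ring)
  have hint : ∀ z : X, IntegrableOn (fun t => e t • T.op t.toNNReal z) (Ioi 0) := fun z => by
    refine (hT.integrableOn_orbit z).norm.mono'
      (hec.smul (T.continuous_orbit_toNNReal z)).aestronglyMeasurable
      (Eventually.of_forall fun t => ?_)
    rw [norm_smul, hen, one_mul]
  have hFTC : ∀ R : ℝ, 0 ≤ R → ∫ t in (0 : ℝ)..R, (e t • T.op t.toNNReal (T.generator x)
      - imagPoint ξ • e t • T.op t.toNNReal (x : X)) = e R • T.op R.toNNReal (x : X) - x := by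
    intro R hR
    have hc : Continuous fun t => e t • T.op t.toNNReal (x : X) :=
      hec.smul (T.continuous_orbit_toNNReal _)
    have hc' : Continuous fun t => e t • T.op t.toNNReal (T.generator x) :=
      hec.smul (T.continuous_orbit_toNNReal _)
    refine (intervalIntegral.integral_eq_sub_of_hasDeriv_right_of_le hR hc.continuousOn
      (fun t ht => ?_) ((hc'.sub (hc.const_smul (imagPoint ξ))).intervalIntegrable _ _)).trans ?_
    rotate_left
    · simp [he, T.op_zero]
    · have h1 := (hed t).hasDerivWithinAt.smul (T.hasDerivWithinAt_orbit x ht.1.le)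
      refine h1.congr_deriv ?_
      rw [neg_mul, neg_smul, mul_smul, ← sub_eq_add_neg]
      rfl
  have hlim1 := intervalIntegral_tendsto_integral_Ioi (0 : ℝ)
    ((hint (T.generator x)).sub ((hint (x : X)).smul (imagPoint ξ))) tendsto_id
  have hlim2 : Tendsto (fun R : ℝ => e R • T.op R.toNNReal (x : X) - x) atTop (𝓝 (0 - x)) := by
    refine Tendsto.sub_const ?_ _
    rw [tendsto_zero_iff_norm_tendsto_zero]
    simpa only [norm_smul, hen, one_mul] using
      tendsto_zero_iff_norm_tendsto_zero.1 (hT.tendsto_orbit (x : X))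
  have h := tendsto_nhds_unique hlim1 (hlim2.congr' (by
    filter_upwards [eventually_ge_atTop 0] with R hR
    exact (hFTC R hR).symm))
  simp only [Pi.sub_apply, Pi.smul_apply] at h
  rw [integral_sub (hint _) (by exact (hint (x : X)).smul (imagPoint ξ)), integral_smul] at h
  rw [hF, hF]
  rw [sub_eq_iff_eq_add] at h
  rw [h]
  abel

theorem ExponentiallyStable.fourier_zeroOrbit_sub_generator [CompleteSpace X]
    (x : T.generator.domain) (ξ : ℝ) :
    𝓕 (T.zeroOrbit ((x : X) - T.generator x)) ξ
      = (1 - imagPoint ξ) • 𝓕 (T.zeroOrbit (x : X)) ξ + (x : X) := by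
  have h1 : T.zeroOrbit ((x : X) - T.generator x)
      = T.zeroOrbit (x : X) + (-1 : ℂ) • T.zeroOrbit (T.generator x) := by
    ext t
    by_cases ht : t ∈ Ioi (0 : ℝ)
    · simp [zeroOrbit, indicator_of_mem ht, sub_eq_add_neg]
    · simp [zeroOrbit, indicator_of_notMem ht]
  have h2 : 𝓕 (T.zeroOrbit ((x : X) - T.generator x)) ξ
      = 𝓕 (T.zeroOrbit (x : X)) ξ - 𝓕 (T.zeroOrbit (T.generator x)) ξ := by
    rw [h1, Real.fourier_eq, Real.fourier_eq, Real.fourier_eq, ← integral_sub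
      ((Real.fourierIntegral_convergent_iff ξ).2 (hT.integrable_zeroOrbit _))
      ((Real.fourierIntegral_convergent_iff ξ).2 (hT.integrable_zeroOrbit _))]
    refine integral_congr_ae (Eventually.of_forall fun t => ?_)
    simp [smul_add, sub_eq_add_neg]
  rw [h2, hT.fourier_zeroOrbit_generator, sub_smul, one_smul]
  abel

theorem ExponentiallyStable.memLp_orbit_self (x : X) :
    MemLp (fun t : ℝ => T.op t.toNNReal x) 2 (volume.restrict (Ioi 0)) :=
  hT.memLp_orbit (.id ℂ X) x

/-- The map `x ↦ T(·) x` from `X` to `L²((0,∞), X)`. -/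
noncomputable def ExponentiallyStable.orbitL :
    X →L[ℂ] Lp X 2 (volume.restrict (Ioi (0 : ℝ))) :=
  LinearMap.mkContinuousOfExistsBound
    { toFun := fun x => (hT.memLp_orbit_self x).toLp fun t : ℝ => T.op t.toNNReal x
      map_add' := fun x y => by
        rw [← MemLp.toLp_add]
        exact MemLp.toLp_congr _ _ (Eventually.of_forall fun t => by simp)
      map_smul' := fun c x => by
        rw [RingHom.id_apply, ← MemLp.toLp_const_smul]
        exact MemLp.toLp_congr _ _ (Eventually.of_forall fun t => by simp) } <| by
    obtain ⟨M, ε, hε, hM⟩ := id hT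
    have hexp : MemLp (fun t : ℝ => Real.exp (-ε * t)) 2 (volume.restrict (Ioi 0)) := by
      rw [memLp_two_iff_integrable_sq (by fun_prop)]
      refine (integrableOn_exp_mul_Ioi (a := -(2 * ε)) (by linarith) 0).congr ?_
      refine Filter.Eventually.of_forall fun t => ?_
      simp only
      rw [← Real.exp_nat_mul]
      congr 1
      push_cast
      ring
    refine ⟨M * ‖hexp.toLp _‖, fun x => ?_⟩
    have h := Lp.norm_le_mul_norm_of_ae_le_mul (c := M * ‖x‖) (g := hexp.toLp _)
      (f := (hT.memLp_orbit_self x).toLp fun t : ℝ => T.op t.toNNReal x) ?_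
    · refine h.trans (le_of_eq (by ring))
    · filter_upwards [ae_restrict_mem measurableSet_Ioi, hexp.coeFn_toLp,
        (hT.memLp_orbit_self x).coeFn_toLp] with t (ht : 0 < t) h1 h2
      have h3 := hM t.toNNReal
      rw [Real.coe_toNNReal t ht.le] at h3
      rw [h1, h2, Real.norm_of_nonneg (Real.exp_pos _).le]
      calc _ ≤ ‖T.op t.toNNReal‖ * ‖x‖ := (T.op t.toNNReal).le_opNorm x
        _ ≤ M * Real.exp (-ε * t) * ‖x‖ := by gcongr
        _ = _ := by ring

theorem ExponentiallyStable.orbitL_ae_eq (x : X) :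
    hT.orbitL x =ᵐ[volume.restrict (Ioi 0)] fun t : ℝ => T.op t.toNNReal x :=
  (hT.memLp_orbit_self x).coeFn_toLp

end C0Semigroup

/-! ### Construction of the strong calculus. -/

namespace C0Semigroup

variable {X : Type*} [NormedAddCommGroup X] [InnerProductSpace ℂ X] [CompleteSpace X]
  {T : C0Semigroup X} (hT : T.ExponentiallyStable)
include hT

theorem ExponentiallyStable.laplace_orbitL_ae_eq (x : X) :
    laplace X (hT.orbitL x) =ᵐ[volume] 𝓕 (T.zeroOrbit x) := by
  have h : extendZero X (hT.orbitL x) = (hT.memLp_zeroOrbit x).toLp _ := by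
    refine Lp.ext ((extendZero_ae_eq _).trans
      (EventuallyEq.trans ?_ (hT.memLp_zeroOrbit x).coeFn_toLp.symm))
    exact (ae_eq_restrict_iff_indicator_ae_eq measurableSet_Ioi).1 (hT.orbitL_ae_eq x)
  rw [laplace_apply, h]
  exact fourier_toLp_ae_eq (hT.integrable_zeroOrbit x) (hT.memLp_zeroOrbit x)

theorem ExponentiallyStable.memLp_fourier_zeroOrbit (x : X) : MemLp (𝓕 (T.zeroOrbit x)) 2 :=
  (memLp_congr_ae (hT.laplace_orbitL_ae_eq x)).1 (Lp.memLp _)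

/-- The operator `x ↦ ∫ g(s) / (1 - s) (𝔏 T(·) x)(s) ds` on `X`. -/
noncomputable def ExponentiallyStable.resolventCalculus {g : ℂ → ℂ} (hg : IsHInfty g) :
    X →L[ℂ] X :=
  (ContinuousLinearMap.lsmul ℂ ℂ).lpPairing volume 2 2 (hg.memLp_boundaryResolvent.toLp _) ∘L
    (laplace X).toContinuousLinearMap ∘L hT.orbitL

theorem ExponentiallyStable.resolventCalculus_apply {g : ℂ → ℂ} (hg : IsHInfty g) (x : X) :
    hT.resolventCalculus hg x = ∫ ξ, boundaryResolvent g ξ • 𝓕 (T.zeroOrbit x) ξ := by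
  refine ((ContinuousLinearMap.lsmul ℂ ℂ).lpPairing_eq_integral _ _).trans ?_
  refine integral_congr_ae ?_
  filter_upwards [hg.memLp_boundaryResolvent.coeFn_toLp, hT.laplace_orbitL_ae_eq x] with ξ h1 h2
  rw [h1]
  exact congrArg _ h2

/-- Translated orbits correspond to modulated Laplace transforms, since `g(s) / (1 - s)` is
orthogonal to the transforms of functions on the negative half-line. -/
theorem ExponentiallyStable.resolventCalculus_op {g : ℂ → ℂ} (hg : IsHInfty g) (x : X) {t : ℝ}
    (ht : 0 ≤ t) : hT.resolventCalculus hg (T.op t.toNNReal x)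
      = 𝓕⁻ (fun ξ => boundaryResolvent g ξ • 𝓕 (T.zeroOrbit x) ξ) t := by
  set W : ℝ → X := T.zeroOrbit x ∘ fun r => r + t with hW
  have hW1 : Integrable W := (hT.integrable_zeroOrbit x).comp_add_right t
  have hW2 : MemLp W 2 :=
    (hT.memLp_zeroOrbit x).comp_measurePreserving (measurePreserving_add_right volume t)
  have hZ1 := hT.integrable_zeroOrbit (T.op t.toNNReal x)
  have hZ2 := hT.memLp_zeroOrbit (T.op t.toNNReal x)
  have hFW : ∀ ξ, 𝓕 W ξ = Complex.exp (2 * Real.pi * ξ * t * Complex.I) • 𝓕 (T.zeroOrbit x) ξ := by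
    intro ξ
    have h := congrFun (Fourier.fourierIntegral_comp_add_right Real.fourierChar volume
      (T.zeroOrbit x) t) ξ
    rw [Circle.smul_def, Real.fourierChar_apply] at h
    have h1 : 𝓕 W ξ = Fourier.fourierIntegral Real.fourierChar volume W ξ := by
      rw [Fourier.fourierIntegral_def, Real.fourier_real_eq]
    have h2 : 𝓕 (T.zeroOrbit x) ξ
        = Fourier.fourierIntegral Real.fourierChar volume (T.zeroOrbit x) ξ := by
      rw [Fourier.fourierIntegral_def, Real.fourier_real_eq]
    rw [h1, h2, hW, h]
    congr 2
    push_cast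
    ring
  have hdiff : ∀ ξ, 𝓕 (W - T.zeroOrbit (T.op t.toNNReal x)) ξ
      = 𝓕 W ξ - 𝓕 (T.zeroOrbit (T.op t.toNNReal x)) ξ := fun ξ => by
    rw [Real.fourier_eq, Real.fourier_eq, Real.fourier_eq, ← integral_sub
      ((Real.fourierIntegral_convergent_iff ξ).2 hW1)
      ((Real.fourierIntegral_convergent_iff ξ).2 hZ1)]
    simp only [Pi.sub_apply, smul_sub]
  -- For r > 0 the semigroup law gives T(r + t)x = T(r)T(t)x, so the shifted orbit W and the orbit
  -- of T(t)x differ only on (-∞, 0].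
  have hzero := hg.integral_boundaryResolvent_smul_fourier_eq_zero (hW1.sub hZ1) (hW2.sub hZ2)
    (Eventually.of_forall fun r hr => by
      simp only [hW, Pi.sub_apply, Function.comp_apply, zeroOrbit]
      rw [indicator_of_mem (show r + t ∈ Ioi (0 : ℝ) from by simp only [mem_Ioi]; linarith),
        indicator_of_mem (show r ∈ Ioi (0 : ℝ) from hr), T.op_toNNReal_add_apply hr.le ht,
        sub_self])
  have hFW2 : MemLp (𝓕 W) 2 := (memLp_congr_ae (fourier_toLp_ae_eq hW1 hW2)).1 (Lp.memLp _)
  have hi1 : Integrable fun ξ => boundaryResolvent g ξ • 𝓕 W ξ :=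
    memLp_one_iff_integrable.1 (hFW2.smul hg.memLp_boundaryResolvent)
  have hi2 : Integrable fun ξ =>
      boundaryResolvent g ξ • 𝓕 (T.zeroOrbit (T.op t.toNNReal x)) ξ :=
    memLp_one_iff_integrable.1 ((hT.memLp_fourier_zeroOrbit _).smul hg.memLp_boundaryResolvent)
  simp only [hdiff, smul_sub] at hzero
  rw [integral_sub hi1 hi2, sub_eq_zero] at hzero
  rw [hT.resolventCalculus_apply, ← hzero, Real.fourierInv_eq']
  refine integral_congr_ae (Eventually.of_forall fun ξ => ?_)
  simp only [hFW]
  rw [smul_comm]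
  congr 2
  simp
  ring

/-- The operator `g(A) : D(A) → X`. -/
noncomputable def ExponentiallyStable.calculus {g : ℂ → ℂ} (hg : IsHInfty g) :
    T.generator.domain →ₗ[ℂ] X :=
  (hT.resolventCalculus hg).toLinearMap ∘ₗ (T.generator.domain.subtype - T.generator.toFun)

theorem ExponentiallyStable.calculus_apply {g : ℂ → ℂ} (hg : IsHInfty g)
    (x : T.generator.domain) :
    hT.calculus hg x = hT.resolventCalculus hg ((x : X) - T.generator x) := rfl

theorem ExponentiallyStable.toeplitz_orbitL_ae_eq {g : ℂ → ℂ} (hg : IsHInfty g)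
    (x : T.generator.domain) : toeplitz X g (hT.orbitL x) =ᵐ[volume.restrict (Ioi 0)]
      fun t => hT.calculus hg (T.domainOrbit x t) := by
  set w : X := (x : X) - T.generator x with hw
  set G : Lp ℂ 2 (volume : Measure ℝ) := hg.memLp_boundaryResolvent.toLp _ with hG
  set S : ℂ →L[ℂ] X := ContinuousLinearMap.toSpanSingleton ℂ (x : X) with hS
  -- Q is g(s)/(1 - s) times the constant vector x. Adding it to g 𝔏(T(·)x) leaves g/(1 - s)
  -- 𝔏(T(·)w), and its inverse transform is invisible on (0,∞).
  set Q : Lp X 2 (volume : Measure ℝ) := S.compLp G with hQ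
  have hae : (boundaryMul X g (laplace X (hT.orbitL x)) + Q : Lp X 2 (volume : Measure ℝ))
      =ᵐ[volume] fun ξ => boundaryResolvent g ξ • 𝓕 (T.zeroOrbit w) ξ := by
    filter_upwards [Lp.coeFn_add (boundaryMul X g (laplace X (hT.orbitL x))) Q,
      boundaryMul_ae_eq g (laplace X (hT.orbitL x)), hT.laplace_orbitL_ae_eq (x : X),
      S.coeFn_compLp G, hg.memLp_boundaryResolvent.coeFn_toLp] with ξ h1 h2 h3 h4 h5
    rw [h1, Pi.add_apply, h2, h3, h4, h5, hw, hT.fourier_zeroOrbit_sub_generator, smul_add,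
      smul_smul, boundaryResolvent, div_mul_cancel₀ _ (one_sub_imagPoint_ne_zero ξ)]
    rfl
  have hP2 : MemLp (fun ξ => boundaryResolvent g ξ • 𝓕 (T.zeroOrbit w) ξ) 2 :=
    (memLp_congr_ae hae).1 (Lp.memLp _)
  have hP1 : Integrable fun ξ => boundaryResolvent g ξ • 𝓕 (T.zeroOrbit w) ξ :=
    memLp_one_iff_integrable.1 ((hT.memLp_fourier_zeroOrbit _).smul hg.memLp_boundaryResolvent)
  have hsplit : boundaryMul X g (laplace X (hT.orbitL x)) = hP2.toLp _ - Q := by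
    rw [eq_sub_iff_add_eq]
    exact Lp.ext (hae.trans hP2.coeFn_toLp.symm)
  have h1 := toeplitz_ae_eq g (hT.orbitL (x : X))
  have hsub : 𝓕⁻ (hP2.toLp _ - Q) = 𝓕⁻ (hP2.toLp _) - 𝓕⁻ Q :=
    (Lp.fourierTransformₗᵢ ℝ X).symm.map_sub _ _
  rw [hsplit, hsub, hQ, fourierInv_compLp] at h1
  filter_upwards [h1, ae_restrict_of_ae (Lp.coeFn_sub (𝓕⁻ (hP2.toLp _)) (S.compLp (𝓕⁻ G))),
    ae_restrict_of_ae (S.coeFn_compLp (𝓕⁻ G)), hg.fourierInv_boundaryResolvent_ae_eq_zero,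
    ae_restrict_of_ae (fourierInv_toLp_ae_eq hP1 hP2), ae_restrict_mem measurableSet_Ioi]
    with t h2 h3 h4 h5 h6 (h7 : 0 < t)
  rw [h2, h3, Pi.sub_apply, h4, h5, h6, Pi.zero_apply, map_zero, sub_zero, hT.calculus_apply,
    T.generator_domainOrbit, ← hT.resolventCalculus_op hg w h7.le, hw, map_sub (T.op _)]
  rfl

theorem ExponentiallyStable.isStrongCalculus_calculus {g : ℂ → ℂ} (hg : IsHInfty g) :
    IsStrongCalculus hT g (hT.calculus hg) := by
  refine ⟨⟨‖hT.resolventCalculus hg‖, fun x => ?_⟩, hT.toeplitz_orbitL_ae_eq hg⟩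
  rw [hT.calculus_apply]
  refine (ContinuousLinearMap.le_opNorm _ _).trans ?_
  gcongr
  exact norm_sub_le _ _

end C0Semigroup

/-! ### The weak and the strong calculus -/

section Calculus

variable {X : Type*} [NormedAddCommGroup X]

theorem IsStrongCalculus.isWeakCalculus [InnerProductSpace ℂ X] [CompleteSpace X]
    {T : C0Semigroup X} {hT : T.ExponentiallyStable} {g : ℂ → ℂ}
    {C : T.generator.domain →ₗ[ℂ] X} (hC : IsStrongCalculus hT g C) : IsWeakCalculus hT g C := by
  refine ⟨hC.1, fun y x => ?_⟩
  have h : (hT.memLp_orbit y (x : X)).toLp (fun t : ℝ => y (T.op t.toNNReal x))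
      = y.compLp (hT.orbitL x) := by
    refine Lp.ext ?_
    filter_upwards [(hT.memLp_orbit y (x : X)).coeFn_toLp, y.coeFn_compLp (hT.orbitL x),
      hT.orbitL_ae_eq (x : X)] with t h1 h2 h3
    rw [h1, h2, h3]
  rw [weakOutput, h]
  filter_upwards [toeplitz_compLp g y (hT.orbitL x), hC.2 x] with t h1 h2
  rw [h1, ← h2]
  rfl

/-- T(t)x → x in the graph norm, because A T(t)x = T(t)Ax. This recovers C x from almost-everywhere
information about C T(·)x. -/
theorem IsGraphBounded.tendsto_domainOrbit [NormedSpace ℂ X] {T : C0Semigroup X} {Y : Type*}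
    [NormedAddCommGroup Y] [NormedSpace ℂ Y] {C : T.generator.domain →ₗ[ℂ] Y}
    (hC : IsGraphBounded T.generator C) (x : T.generator.domain) :
    Tendsto (fun t => C (T.domainOrbit x t)) (𝓝[>] 0) (𝓝 (C x)) := by
  obtain ⟨c, hc⟩ := hC
  have horb : ∀ z : X, Tendsto (fun t : ℝ => ‖T.op t.toNNReal z - z‖) (𝓝[>] 0) (𝓝 0) := fun z => by
    have h : Continuous fun t : ℝ => ‖T.op t.toNNReal z - z‖ :=
      ((T.continuous_orbit_toNNReal z).sub continuous_const).norm
    simpa [T.op_zero] using (h.tendsto 0).mono_left (nhdsWithin_le_nhds (s := Ioi 0))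
  have hlim := ((horb (x : X)).add (horb (T.generator x))).const_mul c
  rw [add_zero, mul_zero] at hlim
  rw [tendsto_iff_norm_sub_tendsto_zero]
  refine squeeze_zero (fun t => norm_nonneg _) (fun t => ?_) hlim
  rw [← map_sub]
  refine (hc _).trans (le_of_eq ?_)
  rw [LinearPMap.map_sub, T.generator_domainOrbit]
  rfl

theorem IsWeakCalculus.unique [NormedSpace ℂ X] {T : C0Semigroup X}
    {hT : T.ExponentiallyStable} {g : ℂ → ℂ} {C C' : T.generator.domain →ₗ[ℂ] X}
    (hC : IsWeakCalculus hT g C) (hC' : IsWeakCalculus hT g C') : C = C' := by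
  refine LinearMap.ext fun x => (SeparatingDual.eq_iff_forall_dual_eq (R := ℂ)).2 fun y => ?_
  have hae := (hC.2 y x).symm.trans (hC'.2 y x)
  have hlim := ((y.continuous.tendsto _).comp (hC.1.tendsto_domainOrbit x)).sub
    ((y.continuous.tendsto _).comp (hC'.1.tendsto_domainOrbit x))
  -- Every interval (0, δ) has positive measure, so an almost-everywhere equality holds at points
  -- arbitrarily close to 0.
  have hfreq : ∃ᶠ t in 𝓝[>] (0 : ℝ),
      y (C (T.domainOrbit x t)) = y (C' (T.domainOrbit x t)) := by
    intro hev
    obtain ⟨δ, hδ, hsub⟩ := mem_nhdsGT_iff_exists_Ioo_subset.1 hev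
    have h0 := ae_restrict_of_ae_restrict_of_subset
      (show Ioo (0 : ℝ) δ ⊆ Ioi 0 from fun t h => h.1) hae
    have h1 : ∀ᵐ t ∂volume.restrict (Ioo (0 : ℝ) δ), False := by
      filter_upwards [h0, ae_restrict_mem measurableSet_Ioo] with t h2 h3
      exact hsub h3 h2
    rw [eventually_false_iff_eq_bot, ae_eq_bot, Measure.restrict_eq_zero, Real.volume_Ioo] at h1
    simp at h1
    exact absurd h1 (not_le.2 hδ)
  have h0 : Tendsto (fun _ : ℝ => (0 : ℂ)) (𝓝[>] 0) (𝓝 0) := tendsto_const_nhds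
  by_contra hne
  have hev := hlim.eventually_ne (sub_ne_zero.2 hne)
  obtain ⟨t, h1, h2⟩ := (hfreq.and_eventually hev).exists
  exact h2 (sub_eq_zero.2 h1)

theorem IsStrongCalculus.isAdmissible [InnerProductSpace ℂ X] [CompleteSpace X]
    {T : C0Semigroup X} {hT : T.ExponentiallyStable} {g : ℂ → ℂ}
    {C : T.generator.domain →ₗ[ℂ] X} (hC : IsStrongCalculus hT g C) : IsAdmissible T C := by
  set B := toeplitz X g ∘L hT.orbitL with hB
  -- The summand 1 only ensures m > 0.
  refine ⟨hC.1, ‖B‖ + 1, by positivity, fun x => ?_⟩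
  have h : B x =ᵐ[volume.restrict (Ioi 0)] fun t => C (T.domainOrbit x t) := hC.2 x
  refine ⟨(memLp_congr_ae h).1 (Lp.memLp _), ?_⟩
  rw [← eLpNorm_congr_ae h, ← Lp.enorm_def, ← ofReal_norm]
  refine ENNReal.ofReal_le_ofReal ((B.le_opNorm _).trans ?_)
  gcongr
  linarith

end Calculus

theorem theorem3p6 {X : Type*} [NormedAddCommGroup X] [InnerProductSpace ℂ X] [CompleteSpace X]
    [TopologicalSpace.SeparableSpace X] (T : C0Semigroup X) (hT : T.ExponentiallyStable)
    (g : ℂ → ℂ) (hg : IsHInfty g) :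
    -- both operators are well defined
    (IsWeakCalculus hT g (weakCalculus hT g) ∧
      ∀ C, IsWeakCalculus hT g C → C = weakCalculus hT g) ∧
    (IsStrongCalculus hT g (strongCalculus hT g) ∧
      ∀ C, IsStrongCalculus hT g C → C = strongCalculus hT g) ∧
    -- the calculi coincide
    weakCalculus hT g = strongCalculus hT g ∧
    lambdaExtension T.generator (weakCalculus hT g) =
      lambdaExtension T.generator (strongCalculus hT g) ∧
    -- the weak calculus is admissible
    IsAdmissible T (weakCalculus hT g) := by
  -- Existence rules out the default value 0 in both definitions. Every uniqueness claim then
  -- reduces to that of the weak calculus.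
  have hex : ∃ C, IsStrongCalculus hT g C := ⟨_, hT.isStrongCalculus_calculus hg⟩
  have hs : IsStrongCalculus hT g (strongCalculus hT g) := by
    rw [strongCalculus, dif_pos hex]
    exact hex.choose_spec
  have hexw : ∃ C, IsWeakCalculus hT g C := ⟨_, hs.isWeakCalculus⟩
  have hw : IsWeakCalculus hT g (weakCalculus hT g) := by
    rw [weakCalculus, dif_pos hexw]
    exact hexw.choose_spec
  have heq : weakCalculus hT g = strongCalculus hT g := hw.unique hs.isWeakCalculus
  exact ⟨⟨hw, fun C hC => hC.unique hw⟩,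
    ⟨hs, fun C hC => hC.isWeakCalculus.unique hs.isWeakCalculus⟩, heq, by rw [heq],
    by rw [heq]; exact hs.isAdmissible⟩
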